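/- **Theorem (Principal connections are complete).** All manifolds are smooth, real, finite-dimensional, Hausdorff, second countable and without boundary. Let $G$ be a Lie group and $\pi: P\to M$ a smooth principal $G$-bundle with right action $\rho_g(p)=p\cdot g$ (i.e. around every point of $M$ there is a fibre-respecting diffeomorphism $\pi^{-1}(U)\cong U\times G$ under which the action becomes right multiplication on $G$). Let a principal connection on $P$ be given, that is, a smooth bundle endomorphism $P_V$ of $TP$ which on each $T_pP$ is a projection onto the vertical space $V_p=\ker T_p\pi$ and which satisfies $P_V\circ T\rho_g=T\rho_g\circ P_V$ for all $g\in G$; a tangent vector is called horizontal if it lies in $\ker P_V$. Let $I\subseteq\mathbb R$ be an interval with more than one point containing $0$, and let $c: I\to M$ be a piecewise $C^1$ curve (continuous, with break points that are finite in number in each compact subinterval of $I$, and $C^1$ up to the end points on each compact subinterval without break points in its interior). Then parallel transport along $c$ is defined for all times: there is a map $$T_c:\ P_{c(0)}\times I\to P,\qquad P_{c(0)}=\pi^{-1}(c(0)),$$ such that for each $p\in P_{c(0)}$ the curve $t\mapsto T_c(p,t)$ is a horizontal lift of $c$ starting at $p$: it is piecewise $C^1$ on all of $I$, $T_c(p,0)=p$,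 $\pi(T_c(p,t))=c(t)$ for all $t\in I$, and $\frac{d}{dt}T_c(p,t)$ is horizontal at every $t\in I$ at which it exists (one-sided at end points of $I$). Moreover: 1. (Uniqueness) every piecewise $C^1$ horizontal lift $\gamma$ of $c$ on $I$ satisfies $\gamma(t)=T_c(\gamma(0),t)$ for all $t\in I$; 2. (Regularity) $T_c$ is continuous; for each $1\le k\le\infty$ and each interval $J\subseteq I$ with more than one point on which $c$ is $C^k$, $T_c$ is $C^k$ on $P_{c(0)}\times J$ (in particular $T_c$ is smooth if $c$ is smooth); and $T_c(\cdot,t)$ is smooth on $P_{c(0)}$ for each $t\in I$; 3. (Reparametrisation) if $c$ is $C^1$ on $I$, $J$ is an interval with more than one point containing $0$ and $\phi: J\to I$ is $C^1$, then $T_c(p,\phi(s))=T_{c\circ\phi}(T_c(p,\phi(0)),s)$ for all $p\in P_{c(0)}$, $s\in J$. -/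

import Mathlib

open scoped Manifold ContDiff Topology

namespace PrincipalConnection

section Defs

variable {EG HG EM HM EF HF : Type*}
  [NormedAddCommGroup EG] [NormedSpace ℝ EG] [TopologicalSpace HG]
  [NormedAddCommGroup EM] [NormedSpace ℝ EM] [TopologicalSpace HM]
  [NormedAddCommGroup EF] [NormedSpace ℝ EF] [TopologicalSpace HF]

/-- A smooth principal `G`-bundle `P → M`: a smooth map `proj`, a smooth right action `act` of `G`
on `P` preserving the fibres, and around every point of `M` a local trivialisation
`proj ⁻¹(U) ≅ U × G` by a fibre-respecting diffeomorphism in which the action is right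
multiplication on the factor `G`. -/
structure PrincipalBundle
    (IG : ModelWithCorners ℝ EG HG) (IM : ModelWithCorners ℝ EM HM)
    (IP : ModelWithCorners ℝ EF HF)
    (G : Type*) [Group G] [TopologicalSpace G] [ChartedSpace HG G]
    (M : Type*) [TopologicalSpace M] [ChartedSpace HM M]
    (P : Type*) [TopologicalSpace P] [ChartedSpace HF P] where
  /-- the bundle projection -/
  proj : P → M
  /-- the principal right action -/
  act : P → G → P
  contMDiff_proj : ContMDiff IP IM ∞ proj
  contMDiff_act : ContMDiff (IP.prod IG) IP ∞ (fun x : P × G => act x.1 x.2)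
  act_one : ∀ p, act p 1 = p
  act_mul : ∀ p g h, act p (g * h) = act (act p g) h
  proj_act : ∀ p g, proj (act p g) = proj p
  exists_trivialisation : ∀ m : M, ∃ (U : Set M) (ψ : OpenPartialHomeomorph P (M × G)),
    IsOpen U ∧ m ∈ U ∧ ψ.source = proj ⁻¹' U ∧ ψ.target = U ×ˢ Set.univ ∧
    (∀ p ∈ ψ.source, (ψ p).1 = proj p) ∧
    (∀ p ∈ ψ.source, ∀ g, ψ (act p g) = ((ψ p).1, (ψ p).2 * g)) ∧
    ContMDiffOn IP (IM.prod IG) ∞ ψ ψ.source ∧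
    ContMDiffOn (IM.prod IG) IP ∞ ψ.symm ψ.target

variable {F : Type*} [TopologicalSpace F] [ChartedSpace HF F]
  {M : Type*} [TopologicalSpace M] [ChartedSpace HM M]

/-- The vertical space `V_f = ker T_f π` of a map `π : F → M` at `f`. -/
noncomputable def verticalSpace (IF : ModelWithCorners ℝ EF HF) (IM : ModelWithCorners ℝ EM HM)
    (π : F → M) (f : F) : Submodule ℝ (TangentSpace IF f) :=
  LinearMap.ker (mfderiv IF IM π f).toLinearMap

/-- A connection on the bundle `π : F → M`, given by its vertical projection `P_V : TF → VF`:
a smooth bundle endomorphism of `TF` which is on every tangent space a linear projection onto the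
vertical space. -/
structure Connection (IF : ModelWithCorners ℝ EF HF) (IM : ModelWithCorners ℝ EM HM)
    [IsManifold IF ∞ F] (π : F → M) where
  /-- the vertical projection `P_V` -/
  vert : ∀ f : F, TangentSpace IF f →L[ℝ] TangentSpace IF f
  contMDiff_vert : ContMDiff IF.tangent IF.tangent ∞
    (fun v : TangentBundle IF F => (⟨v.1, vert v.1 v.2⟩ : TangentBundle IF F))
  vert_mem : ∀ f v, vert f v ∈ verticalSpace IF IM π f
  vert_of_mem : ∀ f, ∀ v ∈ verticalSpace IF IM π f, vert f v = v

/-- A curve `c`, considered on the interval `I` only, is piecewise `C¹`: it is continuous on `I` and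
there is a set `S` of break points, finite in every compact subinterval of `I`, such that `c` is
`C¹` (up to the end points) on every compact subinterval of `I` without break points inside. -/
def IsPiecewiseC1On (IM : ModelWithCorners ℝ EM HM) (I : Set ℝ) (c : ℝ → M) : Prop :=
  ContinuousOn c I ∧ ∃ S : Set ℝ,
    (∀ a b : ℝ, Set.Icc a b ⊆ I → (S ∩ Set.Icc a b).Finite) ∧
    ∀ a b : ℝ, a < b → Set.Icc a b ⊆ I → Disjoint (Set.Ioo a b) S →
      ContMDiffOn 𝓘(ℝ, ℝ) IM 1 c (Set.Icc a b)

namespace Connection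

variable {IF : ModelWithCorners ℝ EF HF} {IM : ModelWithCorners ℝ EM HM}
  [IsManifold IF ∞ F] {π : F → M}

/-- The horizontal space `H_f = ker P_V` at `f`. -/
noncomputable def horizontalSpace (C : Connection IF IM π) (f : F) : Submodule ℝ (TangentSpace IF f) :=
  LinearMap.ker (C.vert f).toLinearMap

/-- `γ` is a horizontal lift of `c` on the interval `I`: a piecewise `C¹` curve over `c` whose
velocity is horizontal wherever it exists (one-sided at end points of `I`). -/
structure IsHorizontalLift (C : Connection IF IM π) (I : Set ℝ) (c : ℝ → M) (γ : ℝ → F) :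
    Prop where
  isPiecewiseC1On : IsPiecewiseC1On IF I γ
  proj_eq : ∀ t ∈ I, π (γ t) = c t
  velocity_mem : ∀ t ∈ I, MDifferentiableWithinAt 𝓘(ℝ, ℝ) IF γ I t →
    mfderivWithin 𝓘(ℝ, ℝ) IF γ I t (1 : ℝ) ∈ C.horizontalSpace (γ t)

/-- `T` is a parallel transport along `c` defined for all starting points `f` in the fibre over
`c 0` and all times `t ∈ I`: each `t ↦ T f t` is a horizontal lift of `c` on `I` starting at `f`.
(Values of `T` at other arguments are irrelevant.) -/
structure IsParallelTransport (C : Connection IF IM π) (I : Set ℝ) (c : ℝ → M)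
    (T : F → ℝ → F) : Prop where
  apply_zero : ∀ f, π f = c 0 → T f 0 = f
  isHorizontalLift : ∀ f, π f = c 0 → C.IsHorizontalLift I c (T f)

/-- A connection on a principal bundle is principal if its vertical projection commutes with the
tangent maps of the right translations `ρ_g : p ↦ p · g`. -/
def IsPrincipal {IG : ModelWithCorners ℝ EG HG} {G : Type*} [Group G] [TopologicalSpace G]
    [ChartedSpace HG G] {B : PrincipalBundle IG IM IF G M F}
    (C : Connection IF IM B.proj) : Prop :=
  ∀ (g : G) (p : F) (v : TangentSpace IF p),
    C.vert (B.act p g) (mfderiv IF IF (fun q => B.act q g) p v) =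
      mfderiv IF IF (fun q => B.act q g) p (C.vert p v)

end Connection

end Defs

end PrincipalConnection

/-! In a bundle chart with base coordinate `x` and fibre coordinate `y`, the kernel of the vertical
projection is the graph `y' = A(x, y) x'` of a smooth family of linear maps. Horizontal lifts are
therefore solutions of an ordinary differential equation. Picard-Lindelöf gives local lifts
(`exists_local_horizontal_lift`), the Lipschitz bound gives uniqueness (`IsPiecewiseLift.eqOn`), and
the equation itself passes the regularity of `x` on to `y` (`contDiffOn_of_hasDerivWithinAt`).

For a general connection solutions may escape along the fibre in finite time. Here a right translate
of a horizontal lift is again horizontal, and `G` is transitive on fibres, so any lift over an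
interval can be moved through any prescribed point over the curve without shortening the interval
(`hasTransitiveLifts`). A compact interval is covered by finitely many local lifts, each translated
to start where the previous one ends (`exists_isPiecewiseLift_Icc`); uniqueness patches the compact
intervals together (`exists_isPiecewiseLift`).

A single lift `γ` then gives the whole transport: `T p t = γ(t) · g(p)`, with `g` smooth on the
initial fibre. Joint regularity follows from smoothness of the action, with no appeal to dependence
of solutions on initial values. Reparametrisation is the chain rule followed by uniqueness. -/

namespace PrincipalConnection

open Set Filter

open Metric
open scoped NNReal

/-! ### Compact relative neighbourhoods in an interval -/

section Intervals

theorem nontrivial_Icc_of_lt {a b : ℝ} (h : a < b) : (Icc a b).Nontrivial :=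
  ⟨a, left_mem_Icc.2 h.le, b, right_mem_Icc.2 h.le, h.ne⟩

/-- Lets interior and end points of `J` be treated alike: localisation always passes to a
nondegenerate compact interval, on which derivatives within the set are unique. -/
theorem exists_Icc_mem_nhdsWithin {J s : Set ℝ} (hJ : J.OrdConnected) (hJ' : J.Nontrivial)
    {t₀ : ℝ} (ht₀ : t₀ ∈ J) (hs : s ∈ 𝓝[J] t₀) :
    ∃ a b : ℝ, a < b ∧ t₀ ∈ Icc a b ∧ Icc a b ⊆ J ∧ Icc a b ⊆ s ∧ Icc a b ∈ 𝓝[J] t₀ := by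
  obtain ⟨δ, hδ, hsub⟩ := Metric.mem_nhdsWithin_iff.1 hs
  have hleft : ∃ a ≤ t₀, a ∈ J ∧ t₀ - δ < a ∧ ((∃ j ∈ J, j < t₀) → a < t₀) ∧
      ∀ᶠ t in 𝓝[J] t₀, a ≤ t := by
    by_cases h : ∃ j ∈ J, j < t₀
    · obtain ⟨j, hj, hjt⟩ := h
      have hlt : max j (t₀ - δ / 2) < t₀ := max_lt hjt (by linarith)
      exact ⟨max j (t₀ - δ / 2), hlt.le, hJ.out hj ht₀ ⟨le_max_left _ _, hlt.le⟩,
        lt_of_lt_of_le (by linarith) (le_max_right _ _), fun _ => hlt,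
        mem_nhdsWithin_of_mem_nhds (Ici_mem_nhds hlt)⟩
    · refine ⟨t₀, le_rfl, ht₀, by linarith, fun h' => (h h').elim, ?_⟩
      filter_upwards [self_mem_nhdsWithin] with t ht
      exact not_lt.1 fun h' => h ⟨t, ht, h'⟩
  have hright : ∃ b ≥ t₀, b ∈ J ∧ b < t₀ + δ ∧ ((∃ j ∈ J, t₀ < j) → t₀ < b) ∧
      ∀ᶠ t in 𝓝[J] t₀, t ≤ b := by
    by_cases h : ∃ j ∈ J, t₀ < j
    · obtain ⟨j, hj, hjt⟩ := h
      have hlt : t₀ < min j (t₀ + δ / 2) := lt_min hjt (by linarith)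
      exact ⟨min j (t₀ + δ / 2), hlt.le, hJ.out ht₀ hj ⟨hlt.le, min_le_left _ _⟩,
        lt_of_le_of_lt (min_le_right _ _) (by linarith), fun _ => hlt,
        mem_nhdsWithin_of_mem_nhds (Iic_mem_nhds hlt)⟩
    · refine ⟨t₀, le_rfl, ht₀, by linarith, fun h' => (h h').elim, ?_⟩
      filter_upwards [self_mem_nhdsWithin] with t ht
      exact not_lt.1 fun h' => h ⟨t, ht, h'⟩
  obtain ⟨a, hat, haJ, haδ, ha, hae⟩ := hleft
  obtain ⟨b, hbt, hbJ, hbδ, hb, hbe⟩ := hright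
  refine ⟨a, b, ?_, ⟨hat, hbt⟩, hJ.out haJ hbJ, fun t ht => hsub ⟨?_, hJ.out haJ hbJ ht⟩, ?_⟩
  · obtain ⟨j, hj, hne⟩ := hJ'.exists_ne t₀
    rcases lt_or_gt_of_ne hne with h | h
    · exact (ha ⟨j, hj, h⟩).trans_le hbt
    · exact hat.trans_lt (hb ⟨j, hj, h⟩)
  · rw [Metric.mem_ball, Real.dist_eq, abs_lt]
    constructor <;> linarith [ht.1, ht.2]
  · filter_upwards [hae, hbe] with t h1 h2 using ⟨h1, h2⟩

end Intervals

/-! ### The equation `y' = A(x, y) u`: existence, uniqueness, regularity -/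

section ODE

variable {E F : Type*} [NormedAddCommGroup E] [NormedSpace ℝ E]
  [NormedAddCommGroup F] [NormedSpace ℝ F]
  {A : E × F → E →L[ℝ] F} {W : Set (E × F)} {x u : ℝ → E} {J : Set ℝ} {t₀ : ℝ}

/-- A `C¹` map is locally Lipschitz and bounded, and `u` is bounded near `t₀`, so one radius and one
pair of constants serve for all nearby times. -/
theorem exists_lipschitzOnWith_closedBall (hA : ContDiffOn ℝ 1 A W) (hW : IsOpen W)
    (hx : ContinuousWithinAt x J t₀) (hu : ContinuousWithinAt u J t₀) {y₀ : F}
    (h₀ : (x t₀, y₀) ∈ W) :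
    ∃ r : ℝ≥0, 0 < r ∧ ∃ K L : ℝ≥0, ∀ᶠ t in 𝓝[J] t₀,
      LipschitzOnWith K (fun y => A (x t, y) (u t)) (closedBall y₀ r) ∧
      ∀ y ∈ closedBall y₀ r, (x t, y) ∈ W ∧ ‖A (x t, y) (u t)‖ ≤ L := by
  have hA₀ : ContDiffAt ℝ 1 A (x t₀, y₀) := hA.contDiffAt (hW.mem_nhds h₀)
  obtain ⟨K, N, hN, hK⟩ := hA₀.exists_lipschitzOnWith
  have hb : ∀ᶠ z in 𝓝 (x t₀, y₀), ‖A z‖₊ < ‖A (x t₀, y₀)‖₊ + 1 :=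
    hA₀.continuousAt.nnnorm.eventually_lt continuousAt_const (lt_add_of_pos_right _ one_pos)
  obtain ⟨ε, hε, hball⟩ := Metric.eventually_nhds_iff.1
    ((hb.and (hW.mem_nhds h₀)).and hN)
  have hub : ∀ᶠ t in 𝓝[J] t₀, ‖u t‖₊ < ‖u t₀‖₊ + 1 :=
    hu.nnnorm.eventually_lt continuousWithinAt_const (lt_add_of_pos_right _ one_pos)
  have hxb : ∀ᶠ t in 𝓝[J] t₀, dist (x t) (x t₀) < ε := hx (Metric.ball_mem_nhds _ hε)
  refine ⟨⟨ε / 2, (half_pos hε).le⟩, half_pos hε, K * (‖u t₀‖₊ + 1),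
    (‖A (x t₀, y₀)‖₊ + 1) * (‖u t₀‖₊ + 1), ?_⟩
  filter_upwards [hub, hxb] with t hut hxt
  have key : ∀ y ∈ closedBall y₀ (ε / 2), dist (x t, y) (x t₀, y₀) < ε := fun y hy => by
    rw [Prod.dist_eq]
    exact max_lt hxt ((mem_closedBall.1 hy).trans_lt (half_lt_self hε))
  refine ⟨LipschitzOnWith.of_dist_le_mul fun y hy y' hy' => ?_, fun y hy => ⟨?_, ?_⟩⟩
  · have h1 := hK.dist_le_mul _ (hball (key y hy)).2 _ (hball (key y' hy')).2
    have h2 : dist (x t, y) (x t, y') = dist y y' := by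
      simp [Prod.dist_eq]
    rw [h2, dist_eq_norm] at h1
    rw [dist_eq_norm, ← sub_apply]
    calc ‖(A (x t, y) - A (x t, y')) (u t)‖ ≤ ‖A (x t, y) - A (x t, y')‖ * ‖u t‖ :=
          ContinuousLinearMap.le_opNorm _ _
      _ ≤ (K * dist y y') * (‖u t₀‖ + 1) := by
          have : ‖u t‖ ≤ ‖u t₀‖ + 1 := hut.le
          gcongr
      _ = _ := by push_cast; ring
  · exact (hball (key y hy)).1.2
  · have h1 : ‖A (x t, y)‖ ≤ ‖A (x t₀, y₀)‖ + 1 := (hball (key y hy)).1.1.le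
    have h2 : ‖u t‖ ≤ ‖u t₀‖ + 1 := hut.le
    calc _ ≤ ‖A (x t, y)‖ * ‖u t‖ := ContinuousLinearMap.le_opNorm _ _
      _ ≤ _ := by push_cast; gcongr

theorem exists_hasDerivWithinAt_Icc [CompleteSpace F] (hA : ContDiffOn ℝ 1 A W) (hW : IsOpen W)
    (hJ : J.OrdConnected) (hJ' : J.Nontrivial) (ht₀ : t₀ ∈ J)
    (hx : ContinuousOn x J) (hu : ContinuousOn u J) {y₀ : F} (h₀ : (x t₀, y₀) ∈ W) :
    ∃ a b : ℝ, a < b ∧ t₀ ∈ Icc a b ∧ Icc a b ⊆ J ∧ Icc a b ∈ 𝓝[J] t₀ ∧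
      ∃ y : ℝ → F, y t₀ = y₀ ∧ ∀ t ∈ Icc a b, (x t, y t) ∈ W ∧
        HasDerivWithinAt y (A (x t, y t) (u t)) (Icc a b) t := by
  obtain ⟨r, hr, K, L, hev⟩ :=
    exists_lipschitzOnWith_closedBall hA hW (hx t₀ ht₀) (hu t₀ ht₀) h₀
  -- At speed at most `L` a solution cannot leave the ball of radius `r` within time `r / (L + 1)`;
  -- the `+ 1` covers `L = 0`.
  have hε : 0 < (r : ℝ) / (L + 1) := by positivity
  have hclose : Icc (t₀ - r / (L + 1)) (t₀ + r / (L + 1)) ∈ 𝓝[J] t₀ :=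
    mem_nhdsWithin_of_mem_nhds (Icc_mem_nhds (by linarith) (by linarith))
  obtain ⟨a, b, hab, ht, hIJ, hsub, hnhds⟩ :=
    exists_Icc_mem_nhdsWithin hJ hJ' ht₀ (hev.and hclose)
  have hPL : IsPicardLindelof (fun t y => A (x t, y) (u t)) (⟨t₀, ht⟩ : Icc a b) y₀ r 0 L K := by
    refine ⟨fun t ht => (hsub ht).1.1, fun y hy => ?_, fun t ht y hy => ((hsub ht).1.2 y hy).2, ?_⟩
    · refine ContinuousOn.clm_apply (hA.continuousOn.comp ?_ ?_) (hu.mono hIJ)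
      · exact (hx.mono hIJ).prodMk continuousOn_const
      · exact fun t ht => ((hsub ht).1.2 y hy).1
    · have h1 := (hsub (left_mem_Icc.2 hab.le)).2.1
      have h2 := (hsub (right_mem_Icc.2 hab.le)).2.2
      have h3 : max (b - t₀) (t₀ - a) ≤ r / (L + 1) := max_le (by linarith) (by linarith)
      calc (L : ℝ) * max (b - t₀) (t₀ - a) ≤ (L + 1) * (r / (L + 1)) := by
            gcongr
            · exact (sub_nonneg.2 ht.2).trans (le_max_left _ _)
            · linarith
        _ = r - (0 : ℝ≥0) := by
            have : (L : ℝ) + 1 ≠ 0 := by positivity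
            field_simp
            simp
  obtain ⟨y, hy₀, hy⟩ := hPL.exists_eq_forall_mem_Icc_hasDerivWithinAt₀
  change y t₀ = y₀ at hy₀
  have hcont : ContinuousWithinAt (fun t => (x t, y t)) (Icc a b) t₀ :=
    ((hx t₀ ht₀).mono hIJ).prodMk (hy t₀ ht).continuousWithinAt
  have hmem : (fun t => (x t, y t)) ⁻¹' W ∈ 𝓝[Icc a b] t₀ :=
    hcont (hW.mem_nhds (by simpa only [hy₀] using h₀))
  -- A second shrinking, by continuity of the solution at `t₀`, keeps `(x, y)` inside `W`.
  obtain ⟨a', b', hab', ht', hsub1, hsub2, hnhds'⟩ :=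
    exists_Icc_mem_nhdsWithin ordConnected_Icc
      (nontrivial_Icc_of_lt hab) ht hmem
  refine ⟨a', b', hab', ht', hsub1.trans hIJ, ?_, y, hy₀,
    fun t ht => ⟨hsub2 ht, (hy t (hsub1 ht)).mono hsub1⟩⟩
  exact nhdsWithin_le_of_mem hnhds hnhds'

/-- Both solutions stay near `t₀` in the ball where the Lipschitz bound holds; the uniqueness
theorem is then applied separately to the right and to the left of `t₀`. -/
theorem eventuallyEq_of_hasDerivWithinAt {a b : ℝ}
    (hA : ContDiffOn ℝ 1 A W) (hW : IsOpen W) (ht₀ : t₀ ∈ Icc a b)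
    (hx : ContinuousOn x (Icc a b)) (hu : ContinuousOn u (Icc a b)) {y y' : ℝ → F}
    (hyW : (x t₀, y t₀) ∈ W)
    (hy : ∀ t ∈ Icc a b, HasDerivWithinAt y (A (x t, y t) (u t)) (Icc a b) t)
    (hy' : ∀ t ∈ Icc a b, HasDerivWithinAt y' (A (x t, y' t) (u t)) (Icc a b) t)
    (h : y t₀ = y' t₀) : ∀ᶠ t in 𝓝[Icc a b] t₀, y t = y' t := by
  obtain ⟨r, hr, K, L, hev⟩ := exists_lipschitzOnWith_closedBall hA hW (hx t₀ ht₀) (hu t₀ ht₀) hyW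
  have hball : ∀ᶠ t in 𝓝[Icc a b] t₀, y t ∈ closedBall (y t₀) r :=
    (hy t₀ ht₀).continuousWithinAt (closedBall_mem_nhds _ hr)
  have hball' : ∀ᶠ t in 𝓝[Icc a b] t₀, y' t ∈ closedBall (y t₀) r := by
    rw [h]; exact (hy' t₀ ht₀).continuousWithinAt (closedBall_mem_nhds _ hr)
  obtain ⟨δ, hδ, hsub⟩ := Metric.mem_nhdsWithin_iff.1 ((hev.and hball).and hball')
  filter_upwards [self_mem_nhdsWithin, mem_nhdsWithin_of_mem_nhds (ball_mem_nhds t₀ hδ)] with t ht htδ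
  rw [Metric.mem_ball, Real.dist_eq, abs_lt] at htδ
  have hcont : ContinuousOn y (Icc a b) := fun s hs => (hy s hs).continuousWithinAt
  have hcont' : ContinuousOn y' (Icc a b) := fun s hs => (hy' s hs).continuousWithinAt
  rcases le_total t₀ t with htt | htt
  · have hs1 : Icc t₀ t ⊆ Icc a b := Icc_subset_Icc ht₀.1 ht.2
    have hs2 : ∀ s ∈ Icc t₀ t, s ∈ ball t₀ δ ∩ Icc a b := fun s hs => by
      refine ⟨?_, hs1 hs⟩
      rw [Metric.mem_ball, Real.dist_eq, abs_lt]
      constructor <;> linarith [hs.1, hs.2]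
    have hd : ∀ s ∈ Ico t₀ t, Icc a b ∈ 𝓝[≥] s := fun s hs =>
      mem_of_superset (Icc_mem_nhdsGE hs.2) (Icc_subset_Icc (ht₀.1.trans hs.1) ht.2)
    exact ODE_solution_unique_of_mem_Icc_right (v := fun t y => A (x t, y) (u t))
      (s := fun _ => closedBall (y t₀) r) (K := K)
      (fun s hs => (hsub (hs2 s (Ico_subset_Icc_self hs))).1.1.1) (hcont.mono hs1)
      (fun s hs => (hy s (hs1 (Ico_subset_Icc_self hs))).mono_of_mem_nhdsWithin (hd s hs))
      (fun s hs => (hsub (hs2 s (Ico_subset_Icc_self hs))).1.2) (hcont'.mono hs1)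
      (fun s hs => (hy' s (hs1 (Ico_subset_Icc_self hs))).mono_of_mem_nhdsWithin (hd s hs))
      (fun s hs => (hsub (hs2 s (Ico_subset_Icc_self hs))).2) h (right_mem_Icc.2 htt)
  · have hs1 : Icc t t₀ ⊆ Icc a b := Icc_subset_Icc ht.1 ht₀.2
    have hs2 : ∀ s ∈ Icc t t₀, s ∈ ball t₀ δ ∩ Icc a b := fun s hs => by
      refine ⟨?_, hs1 hs⟩
      rw [Metric.mem_ball, Real.dist_eq, abs_lt]
      constructor <;> linarith [hs.1, hs.2]
    have hd : ∀ s ∈ Ioc t t₀, Icc a b ∈ 𝓝[≤] s := fun s hs =>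
      mem_of_superset (Icc_mem_nhdsLE hs.1) (Icc_subset_Icc ht.1 (hs.2.trans ht₀.2))
    exact ODE_solution_unique_of_mem_Icc_left (v := fun t y => A (x t, y) (u t))
      (s := fun _ => closedBall (y t₀) r) (K := K)
      (fun s hs => (hsub (hs2 s (Ioc_subset_Icc_self hs))).1.1.1) (hcont.mono hs1)
      (fun s hs => (hy s (hs1 (Ioc_subset_Icc_self hs))).mono_of_mem_nhdsWithin (hd s hs))
      (fun s hs => (hsub (hs2 s (Ioc_subset_Icc_self hs))).1.2) (hcont'.mono hs1)
      (fun s hs => (hy' s (hs1 (Ioc_subset_Icc_self hs))).mono_of_mem_nhdsWithin (hd s hs))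
      (fun s hs => (hsub (hs2 s (Ioc_subset_Icc_self hs))).2) h (left_mem_Icc.2 htt)

/-- Bootstrapping: if `x` is `C^(n+1)` and `y` is `C^n`, then `y' = A(x, y) x'` is `C^n`. -/
theorem contDiffOn_of_hasDerivWithinAt {K : Set ℝ} (hK : UniqueDiffOn ℝ K)
    (hA : ContDiffOn ℝ ∞ A W) {y : ℝ → F} (hyW : ∀ t ∈ K, (x t, y t) ∈ W)
    (hy : ∀ t ∈ K, HasDerivWithinAt y (A (x t, y t) (derivWithin x K t)) K t) {k : ℕ∞}
    (hx : ContDiffOn ℝ k x K) : ContDiffOn ℝ k y K := by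
  have hnat : ∀ n : ℕ, ContDiffOn ℝ n x K → ContDiffOn ℝ n y K := by
    intro n
    induction n with
    | zero =>
      intro _
      exact contDiffOn_zero.2 fun t ht => (hy t ht).continuousWithinAt
    | succ n ih =>
      intro hx
      have hx' := hx
      push_cast at hx' ⊢
      rw [contDiffOn_succ_iff_derivWithin hK] at hx' ⊢
      refine ⟨fun t ht => (hy t ht).differentiableWithinAt, by simp, ?_⟩
      have hxn : ContDiffOn ℝ n x K := hx.of_le (by push_cast; exact le_self_add)
      refine ContDiffOn.congr ?_ fun t ht => (hy t ht).derivWithin (hK t ht)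
      refine ContDiffOn.clm_apply ?_ hx'.2.2
      exact (hA.of_le (mod_cast le_top)).comp (hxn.prodMk (ih hxn)) hyW
  induction k with
  | top => exact contDiffOn_infty.2 fun n => hnat n (contDiffOn_infty.1 hx n)
  | coe n => exact hnat n hx

end ODE

/-! ### Vector-space charts adapted to the projection -/

section Coordinates

variable {EG HG EM HM EP HP : Type*}
  [NormedAddCommGroup EG] [NormedSpace ℝ EG] [TopologicalSpace HG]
  [NormedAddCommGroup EM] [NormedSpace ℝ EM] [TopologicalSpace HM]
  [NormedAddCommGroup EP] [NormedSpace ℝ EP] [TopologicalSpace HP]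
  {IG : ModelWithCorners ℝ EG HG} {IM : ModelWithCorners ℝ EM HM} {IP : ModelWithCorners ℝ EP HP}
  {G : Type*} [TopologicalSpace G] [ChartedSpace HG G]
  {M : Type*} [TopologicalSpace M] [ChartedSpace HM M]
  {P : Type*} [TopologicalSpace P] [ChartedSpace HP P]

variable (IM) in
/-- Around every point of a boundaryless manifold there is a chart with open image in the model
vector space, smooth in both directions. -/
theorem exists_smooth_vectorSpace_chart [IsManifold IM ∞ M] [BoundarylessManifold IM M] (m : M) :
    ∃ e : OpenPartialHomeomorph M EM, m ∈ e.source ∧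
      ContMDiffOn IM 𝓘(ℝ, EM) ∞ e e.source ∧ ContMDiffOn 𝓘(ℝ, EM) IM ∞ e.symm e.target := by
  refine ⟨{
    toFun := extChartAt IM m
    invFun := (extChartAt IM m).symm
    source := (extChartAt IM m).source ∩ extChartAt IM m ⁻¹' interior (extChartAt IM m).target
    target := interior (extChartAt IM m).target
    map_source' := fun _ h => h.2
    map_target' := fun z h => ⟨(extChartAt IM m).map_target (interior_subset h), by
      rw [mem_preimage, (extChartAt IM m).right_inv (interior_subset h)]; exact h⟩
    left_inv' := fun _ h => (extChartAt IM m).left_inv h.1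
    right_inv' := fun _ h => (extChartAt IM m).right_inv (interior_subset h)
    open_source := (continuousOn_extChartAt m).isOpen_inter_preimage
      (isOpen_extChartAt_source m) isOpen_interior
    open_target := isOpen_interior
    continuousOn_toFun := (continuousOn_extChartAt m).mono inter_subset_left
    continuousOn_invFun := (continuousOn_extChartAt_symm m).mono interior_subset }, ?_, ?_, ?_⟩
  · exact ⟨mem_extChartAt_source m,
      IM.isInteriorPoint_iff.1 (BoundarylessManifold.isInteriorPoint' m)⟩
  · refine contMDiffOn_extChartAt.mono fun p hp => ?_
    exact (extChartAt_source IM m) ▸ hp.1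
  · exact (contMDiffOn_extChartAt_symm m).mono interior_subset

variable [Group G]

theorem exists_bundle_chart [IsManifold IM ∞ M] [BoundarylessManifold IM M]
    [IsManifold IG ∞ G] [BoundarylessManifold IG G]
    (B : PrincipalBundle IG IM IP G M P) (p₀ : P) :
    ∃ (eM : OpenPartialHomeomorph M EM) (e : OpenPartialHomeomorph P (EM × EG)),
      p₀ ∈ e.source ∧
      ContMDiffOn IM 𝓘(ℝ, EM) ∞ eM eM.source ∧ ContMDiffOn 𝓘(ℝ, EM) IM ∞ eM.symm eM.target ∧
      ContMDiffOn IP 𝓘(ℝ, EM × EG) ∞ e e.source ∧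
      ContMDiffOn 𝓘(ℝ, EM × EG) IP ∞ e.symm e.target ∧
      ∀ p ∈ e.source, B.proj p ∈ eM.source ∧ (e p).1 = eM (B.proj p) := by
  obtain ⟨U, ψ, -, hmU, hs, -, hfst, -, hψ, hψ'⟩ := B.exists_trivialisation (B.proj p₀)
  have hp₀ : p₀ ∈ ψ.source := by rw [hs]; exact hmU
  obtain ⟨eM, hm, heM, heM'⟩ := exists_smooth_vectorSpace_chart IM (B.proj p₀)
  obtain ⟨eG, hg, heG, heG'⟩ := exists_smooth_vectorSpace_chart IG (ψ p₀).2
  refine ⟨eM, ψ.trans (eM.prod eG), ?_, heM, heM', ?_, ?_, ?_⟩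
  · simp only [OpenPartialHomeomorph.trans_source, mem_inter_iff, mem_preimage,
      OpenPartialHomeomorph.prod_source, mem_prod, hfst p₀ hp₀]
    exact ⟨hp₀, hm, hg⟩
  · have hψe : ContMDiffOn IP (IM.prod IG) ∞ ψ (ψ.trans (eM.prod eG)).source :=
      hψ.mono fun p hp => hp.1
    exact (heM.comp (contMDiff_fst.comp_contMDiffOn hψe) fun p hp => hp.2.1).prodMk_space
      (heG.comp (contMDiff_snd.comp_contMDiffOn hψe) fun p hp => hp.2.2)
  · refine hψ'.comp (ContMDiffOn.prodMk ?_ ?_) fun z hz => hz.2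
    · exact heM'.comp contDiff_fst.contMDiff.contMDiffOn fun z hz => hz.1.1
    · exact heG'.comp contDiff_snd.contMDiff.contMDiffOn fun z hz => hz.1.2
  · intro p hp
    have h1 : p ∈ ψ.source := hp.1
    have h2 : (ψ p).1 ∈ eM.source := hp.2.1
    rw [hfst p h1] at h2
    refine ⟨h2, ?_⟩
    change eM (ψ p).1 = _
    rw [hfst p h1]

end Coordinates

/-! ### Horizontality in coordinates -/

section ConnectionForm

variable {EF EM HM EP HP : Type*}
  [NormedAddCommGroup EF] [NormedSpace ℝ EF]
  [NormedAddCommGroup EM] [NormedSpace ℝ EM] [TopologicalSpace HM]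
  [NormedAddCommGroup EP] [NormedSpace ℝ EP] [TopologicalSpace HP]
  {IM : ModelWithCorners ℝ EM HM} {IP : ModelWithCorners ℝ EP HP}
  {M : Type*} [TopologicalSpace M] [ChartedSpace HM M]
  {P : Type*} [TopologicalSpace P] [ChartedSpace HP P]
  {π : P → M} {eM : OpenPartialHomeomorph M EM} {e : OpenPartialHomeomorph P (EM × EF)}

/-- Differentiate `fst ∘ e = eM ∘ π` and use that the derivative of `eM` is injective. -/
theorem mem_verticalSpace_iff (hπ : ContMDiff IP IM ∞ π)
    (heM : ContMDiffOn IM 𝓘(ℝ, EM) ∞ eM eM.source)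
    (heM' : ContMDiffOn 𝓘(ℝ, EM) IM ∞ eM.symm eM.target)
    (he : ContMDiffOn IP 𝓘(ℝ, EM × EF) ∞ e e.source)
    (hfst : ∀ p ∈ e.source, π p ∈ eM.source ∧ (e p).1 = eM (π p)) {p : P} (hp : p ∈ e.source)
    (v : TangentSpace IP p) :
    v ∈ verticalSpace IP IM π p ↔ (mfderiv IP 𝓘(ℝ, EM × EF) e p v : EM × EF).1 = 0 := by
  have hdM : eM.MDifferentiable IM 𝓘(ℝ, EM) :=
    ⟨heM.mdifferentiableOn (by simp), heM'.mdifferentiableOn (by simp)⟩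
  have h1 : HasMFDerivAt IP 𝓘(ℝ, EM) (fun q => (e q).1) p
      ((ContinuousLinearMap.fst ℝ EM EF).comp (mfderiv IP 𝓘(ℝ, EM × EF) e p)) := by
    refine HasMFDerivAt.comp (I' := 𝓘(ℝ, EM × EF)) p
      (ContinuousLinearMap.hasMFDerivAt (ContinuousLinearMap.fst ℝ EM EF)) ?_
    exact ((he.mdifferentiableOn (by simp) p hp).mdifferentiableAt
      (e.open_source.mem_nhds hp)).hasMFDerivAt
  have h2 : HasMFDerivAt IP 𝓘(ℝ, EM) (fun q => (e q).1) p
      ((mfderiv IM 𝓘(ℝ, EM) eM (π p)).comp (mfderiv IP IM π p)) := by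
    refine (HasMFDerivAt.comp p (hdM.mdifferentiableAt (hfst p hp).1).hasMFDerivAt
      ((hπ p).mdifferentiableAt (by simp)).hasMFDerivAt).congr_of_eventuallyEq ?_
    filter_upwards [e.open_source.mem_nhds hp] with q hq using (hfst q hq).2
  have h3 := congrArg (fun L => L v) (hasMFDerivAt_unique h1 h2)
  change (mfderiv IP 𝓘(ℝ, EM × EF) e p v : EM × EF).1 =
    mfderiv IM 𝓘(ℝ, EM) eM (π p) (mfderiv IP IM π p v) at h3
  rw [h3]
  change mfderiv IP IM π p v = 0 ↔ _
  constructor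
  · intro h; rw [h]; exact map_zero _
  · intro h
    exact hdM.mfderiv_injective (hfst p hp).1 (h.trans (map_zero _).symm)

variable [IsManifold IP ∞ P]

variable (e) in
/-- The Christoffel form of a connection in a bundle chart. -/
noncomputable def Connection.christoffel (C : Connection IP IM π) (z : EM × EF) : EM →L[ℝ] EF :=
  (ContinuousLinearMap.snd ℝ EM EF).comp <|
    (show EP →L[ℝ] EM × EF from mfderivWithin IP 𝓘(ℝ, EM × EF) e e.source (e.symm z)).comp <|
      (show EP →L[ℝ] EP from C.vert (e.symm z)).comp <|
        (show EM × EF →L[ℝ] EP from mfderivWithin 𝓘(ℝ, EM × EF) IP e.symm e.target z).comp <|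
          ContinuousLinearMap.inl ℝ EM EF

/-- As `EM` is finite-dimensional, smoothness may be tested on each fixed vector `u`. There the map
is the constant field `(u, 0)` pushed through tangent maps of the charts and the smooth bundle map
`vert`. -/
theorem Connection.contDiffOn_christoffel [FiniteDimensional ℝ EM] (C : Connection IP IM π)
    (he : ContMDiffOn IP 𝓘(ℝ, EM × EF) ∞ e e.source)
    (he' : ContMDiffOn 𝓘(ℝ, EM × EF) IP ∞ e.symm e.target) :
    ContDiffOn ℝ ∞ (C.christoffel e) e.target := by
  rw [contDiffOn_clm_apply]
  intro u
  have h1 : ContMDiffOn 𝓘(ℝ, EM × EF) 𝓘(ℝ, EM × EF).tangent ∞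
      (fun z : EM × EF => (⟨z, ((u, 0) : EM × EF)⟩ : TangentBundle 𝓘(ℝ, EM × EF) (EM × EF)))
      e.target := by
    intro z _
    exact contMDiffWithinAt_vectorSpace_iff_contDiffWithinAt.2 contDiffWithinAt_const
  have h2 := he'.contMDiffOn_tangentMapWithin (m := ∞) (by simp) e.open_target.uniqueMDiffOn
  have h3 := he.contMDiffOn_tangentMapWithin (m := ∞) (by simp) e.open_source.uniqueMDiffOn
  have h4 := contMDiff_snd_tangentBundle_modelSpace (n := ∞) (EM × EF) 𝓘(ℝ, EM × EF)
  have h5 := h4.comp_contMDiffOn (h3.comp (C.contMDiff_vert.comp_contMDiffOn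
    (h2.comp h1 fun z hz => hz)) fun z hz => e.map_target hz)
  refine ((contDiff_snd.contMDiff (n := ∞)).comp_contMDiffOn h5).contDiffOn.congr fun z _ => ?_
  rfl

/-- In coordinates the projection sends `(a, b)` to `(0, Γ a + b)`: it fixes the vertical vector
`(0, b)`, and `Γ a` is by definition the fibre part of the image of `(a, 0)`. -/
theorem Connection.vert_eq_zero_iff (C : Connection IP IM π) (hπ : ContMDiff IP IM ∞ π)
    (heM : ContMDiffOn IM 𝓘(ℝ, EM) ∞ eM eM.source)
    (heM' : ContMDiffOn 𝓘(ℝ, EM) IM ∞ eM.symm eM.target)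
    (he : ContMDiffOn IP 𝓘(ℝ, EM × EF) ∞ e e.source)
    (he' : ContMDiffOn 𝓘(ℝ, EM × EF) IP ∞ e.symm e.target)
    (hfst : ∀ p ∈ e.source, π p ∈ eM.source ∧ (e p).1 = eM (π p)) {p : P} (hp : p ∈ e.source)
    (v : TangentSpace IP p) :
    C.vert p v = 0 ↔ (mfderiv IP 𝓘(ℝ, EM × EF) e p v : EM × EF).2 =
      -C.christoffel e (e p) (mfderiv IP 𝓘(ℝ, EM × EF) e p v : EM × EF).1 := by
  have hd : e.MDifferentiable IP 𝓘(ℝ, EM × EF) :=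
    ⟨he.mdifferentiableOn (by simp), he'.mdifferentiableOn (by simp)⟩
  have hvert := fun w => mem_verticalSpace_iff hπ heM heM' he hfst hp w
  -- The derivatives and the projection become plain maps of model spaces; what remains is linear
  -- algebra.
  obtain ⟨D, hD⟩ : ∃ D : EP →L[ℝ] EM × EF, D = mfderiv IP 𝓘(ℝ, EM × EF) e p := ⟨_, rfl⟩
  obtain ⟨D', hD'⟩ : ∃ D' : EM × EF →L[ℝ] EP, D' = mfderiv 𝓘(ℝ, EM × EF) IP e.symm (e p) :=
    ⟨_, rfl⟩
  obtain ⟨V, hV⟩ : ∃ V : EP →L[ℝ] EP, V = C.vert p := ⟨_, rfl⟩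
  have hA : ∀ u : EM, C.christoffel e (e p) u = (D (V (D' (u, 0)))).2 := by
    intro u
    rw [hD, hD', hV, ← mfderivWithin_of_isOpen e.open_source hp,
      ← mfderivWithin_of_isOpen e.open_target (e.map_source hp)]
    exact congrArg (fun q => ((show EP →L[ℝ] EM × EF from
      mfderivWithin IP 𝓘(ℝ, EM × EF) e e.source q) ((show EP →L[ℝ] EP from C.vert q)
        ((show EM × EF →L[ℝ] EP from mfderivWithin 𝓘(ℝ, EM × EF) IP e.symm e.target (e p))
          (u, 0)))).2) (e.left_inv hp)
  have hDD' : ∀ w, D (D' w) = w := fun w => by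
    rw [hD, hD']
    have := congrArg (fun L => L w) (hd.comp_symm_deriv (e.map_source hp))
    rw [e.left_inv hp] at this
    exact this
  have hD'D : ∀ w, D' (D w) = w := fun w => by
    rw [hD, hD']
    exact congrArg (fun L => L w) (hd.symm_comp_deriv hp)
  have hv1 : ∀ w : EP, (D (V w)).1 = 0 := fun w => by
    rw [hD, hV]; exact (hvert _).1 (C.vert_mem p w)
  have hv2 : ∀ w : EP, (D w).1 = 0 → V w = w := by
    rw [hD, hV]; exact fun w hw => C.vert_of_mem p w ((hvert w).2 hw)
  suffices h : ∀ v : EP, V v = 0 ↔ (D v).2 = -C.christoffel e (e p) (D v).1 by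
    rw [hV, hD] at h; exact h v
  clear v
  intro v
  have hsplit : V v = V (D' ((D v).1, 0)) + D' (0, (D v).2) := by
    rw [← hv2 (D' (0, (D v).2)) (by rw [hDD']), ← map_add, ← map_add]
    simp [hD'D]
  have hDV : D (V v) = (0, C.christoffel e (e p) (D v).1 + (D v).2) := by
    refine Prod.ext (hv1 v) ?_
    rw [hsplit, map_add, hDD', hA]
    rfl
  constructor
  · intro h
    rw [h, map_zero] at hDV
    exact eq_neg_of_add_eq_zero_right (congrArg Prod.snd hDV).symm
  · intro h
    rw [h, add_neg_cancel] at hDV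
    rw [← hD'D (V v), hDV]
    exact map_zero _

/-- A bundle chart `e` over a chart `eM` of the base in which a curve `(x, y)` is horizontal iff
`y' = A (x, y) x'`. -/
structure IsAdaptedChart (C : Connection IP IM π) (eM : OpenPartialHomeomorph M EM)
    (e : OpenPartialHomeomorph P (EM × EF)) (A : EM × EF → EM →L[ℝ] EF) : Prop where
  contMDiffOn_base : ContMDiffOn IM 𝓘(ℝ, EM) ∞ eM eM.source
  contMDiffOn_chart : ContMDiffOn IP 𝓘(ℝ, EM × EF) ∞ e e.source
  contMDiffOn_symm : ContMDiffOn 𝓘(ℝ, EM × EF) IP ∞ e.symm e.target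
  proj_mem : ∀ p ∈ e.source, π p ∈ eM.source
  fst_eq : ∀ p ∈ e.source, (e p).1 = eM (π p)
  contDiffOn_coeff : ContDiffOn ℝ ∞ A e.target
  vert_eq_zero_iff : ∀ p ∈ e.source, ∀ v : TangentSpace IP p, C.vert p v = 0 ↔
    (mfderiv IP 𝓘(ℝ, EM × EF) e p v : EM × EF).2 =
      A (e p) (mfderiv IP 𝓘(ℝ, EM × EF) e p v : EM × EF).1

end ConnectionForm

theorem exists_isAdaptedChart {EG HG EM HM EP HP : Type*}
    [NormedAddCommGroup EG] [NormedSpace ℝ EG] [TopologicalSpace HG]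
    [NormedAddCommGroup EM] [NormedSpace ℝ EM] [FiniteDimensional ℝ EM] [TopologicalSpace HM]
    [NormedAddCommGroup EP] [NormedSpace ℝ EP] [TopologicalSpace HP]
    {IG : ModelWithCorners ℝ EG HG} {IM : ModelWithCorners ℝ EM HM}
    {IP : ModelWithCorners ℝ EP HP}
    {G : Type*} [Group G] [TopologicalSpace G] [ChartedSpace HG G] [IsManifold IG ∞ G]
    [BoundarylessManifold IG G]
    {M : Type*} [TopologicalSpace M] [ChartedSpace HM M] [IsManifold IM ∞ M]
    [BoundarylessManifold IM M]
    {P : Type*} [TopologicalSpace P] [ChartedSpace HP P] [IsManifold IP ∞ P]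
    {B : PrincipalBundle IG IM IP G M P} (C : Connection IP IM B.proj) (p₀ : P) :
    ∃ (eM : OpenPartialHomeomorph M EM) (e : OpenPartialHomeomorph P (EM × EG))
      (A : EM × EG → EM →L[ℝ] EG), p₀ ∈ e.source ∧ IsAdaptedChart C eM e A := by
  obtain ⟨eM, e, hp₀, heM, heM', he, he', hfst⟩ := exists_bundle_chart B p₀
  exact ⟨eM, e, fun z => -C.christoffel e z, hp₀, heM, he, he', fun p hp => (hfst p hp).1,
    fun p hp => (hfst p hp).2, (C.contDiffOn_christoffel he he').neg,
    fun p hp v => C.vert_eq_zero_iff B.contMDiff_proj heM heM' he he' hfst hp v⟩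

/-! ### Local horizontal lifts of `C¹` curves -/

section Lifts

variable {EF EM HM EP HP : Type*}
  [NormedAddCommGroup EF] [NormedSpace ℝ EF]
  [NormedAddCommGroup EM] [NormedSpace ℝ EM] [TopologicalSpace HM]
  [NormedAddCommGroup EP] [NormedSpace ℝ EP] [TopologicalSpace HP]
  {IM : ModelWithCorners ℝ EM HM} {IP : ModelWithCorners ℝ EP HP}
  {M : Type*} [TopologicalSpace M] [ChartedSpace HM M]
  {P : Type*} [TopologicalSpace P] [ChartedSpace HP P]
  {π : P → M} {eM : OpenPartialHomeomorph M EM} {e : OpenPartialHomeomorph P (EM × EF)}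
  {A : EM × EF → EM →L[ℝ] EF}

theorem mfderivWithin_Icc_of_subset {γ : ℝ → P} {K : Set ℝ} {a b t : ℝ} (hab : a < b)
    (ht : t ∈ Icc a b) (hsub : Icc a b ⊆ K)
    (h : MDifferentiableWithinAt 𝓘(ℝ, ℝ) IP γ K t) :
    mfderivWithin 𝓘(ℝ, ℝ) IP γ (Icc a b) t = mfderivWithin 𝓘(ℝ, ℝ) IP γ K t :=
  h.mfderivWithin_mono ((uniqueDiffOn_Icc hab).uniqueMDiffOn t ht) hsub

variable [IsManifold IP ∞ P] {C : Connection IP IM π}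

namespace IsAdaptedChart

variable {γ : ℝ → P} {K : Set ℝ}

theorem contDiffOn_comp (h : IsAdaptedChart C eM e A) {n : WithTop ℕ∞} (hn : n ≤ ∞) (hγ : ContMDiffOn 𝓘(ℝ, ℝ) IP n γ K)
    (hmaps : MapsTo γ K e.source) : ContDiffOn ℝ n (fun t => e (γ t)) K :=
  ((h.contMDiffOn_chart.of_le hn).comp hγ hmaps).contDiffOn

theorem horizontal_iff (h : IsAdaptedChart C eM e A) {a b : ℝ} (hab : a < b) {t : ℝ} (ht : t ∈ Icc a b)
    (hγ : MDifferentiableWithinAt 𝓘(ℝ, ℝ) IP γ (Icc a b) t) (hs : γ t ∈ e.source) :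
    C.vert (γ t) (mfderivWithin 𝓘(ℝ, ℝ) IP γ (Icc a b) t (1 : ℝ)) = 0 ↔
      HasDerivWithinAt (fun t => (e (γ t)).2)
        (A (e (γ t)) (derivWithin (fun t => (e (γ t)).1) (Icc a b) t)) (Icc a b) t := by
  have huniq : UniqueDiffWithinAt ℝ (Icc a b) t := uniqueDiffOn_Icc hab t ht
  have he : MDifferentiableAt IP 𝓘(ℝ, EM × EF) e (γ t) :=
    (h.contMDiffOn_chart.mdifferentiableOn (by simp) _ hs).mdifferentiableAt
      (e.open_source.mem_nhds hs)
  have hcomp : HasFDerivWithinAt (fun t => e (γ t))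
      ((show EP →L[ℝ] EM × EF from mfderiv IP 𝓘(ℝ, EM × EF) e (γ t)).comp
        (show ℝ →L[ℝ] EP from mfderivWithin 𝓘(ℝ, ℝ) IP γ (Icc a b) t)) (Icc a b) t :=
    (he.hasMFDerivAt.comp_hasMFDerivWithinAt t hγ.hasMFDerivWithinAt).hasFDerivWithinAt
  have hd : HasDerivWithinAt (fun t => e (γ t))
      (mfderiv IP 𝓘(ℝ, EM × EF) e (γ t) (mfderivWithin 𝓘(ℝ, ℝ) IP γ (Icc a b) t (1 : ℝ)) : EM × EF)
      (Icc a b) t := hcomp.hasDerivWithinAt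
  rw [h.vert_eq_zero_iff _ hs]
  generalize (mfderiv IP 𝓘(ℝ, EM × EF) e (γ t)
    (mfderivWithin 𝓘(ℝ, ℝ) IP γ (Icc a b) t (1 : ℝ)) : EM × EF) = w at hd ⊢
  have h1 : HasDerivWithinAt (fun t => (e (γ t)).1) w.1 (Icc a b) t :=
    (ContinuousLinearMap.fst ℝ EM EF).hasFDerivAt.comp_hasDerivWithinAt t hd
  have h2 : HasDerivWithinAt (fun t => (e (γ t)).2) w.2 (Icc a b) t :=
    (ContinuousLinearMap.snd ℝ EM EF).hasFDerivAt.comp_hasDerivWithinAt t hd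
  rw [h1.derivWithin huniq]
  constructor
  · intro h3; rwa [← h3]
  · intro h3; exact huniq.eq_deriv _ h2 h3

end IsAdaptedChart

variable (EF) in
/-- Every point of the total space lies in an adapted chart. -/
def HasAdaptedCharts (C : Connection IP IM π) : Prop :=
  ∀ p : P, ∃ (eM : OpenPartialHomeomorph M EM) (e : OpenPartialHomeomorph P (EM × EF))
    (A : EM × EF → EM →L[ℝ] EF), p ∈ e.source ∧ IsAdaptedChart C eM e A

/-- `γ` is `C¹` with horizontal velocity on the set `K`. -/
def IsHorizontalOn (C : Connection IP IM π) (K : Set ℝ) (γ : ℝ → P) : Prop :=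
  ContMDiffOn 𝓘(ℝ, ℝ) IP 1 γ K ∧
    ∀ t ∈ K, C.vert (γ t) (mfderivWithin 𝓘(ℝ, ℝ) IP γ K t (1 : ℝ)) = 0

theorem IsHorizontalOn.mono_Icc {γ : ℝ → P} {K : Set ℝ} {a b : ℝ} (h : IsHorizontalOn C K γ)
    (hab : a < b) (hsub : Icc a b ⊆ K) : IsHorizontalOn C (Icc a b) γ := by
  refine ⟨h.1.mono hsub, fun t ht => ?_⟩
  rw [mfderivWithin_Icc_of_subset hab ht hsub (h.1.mdifferentiableOn (by simp) t (hsub ht))]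
  exact h.2 t (hsub ht)

theorem IsAdaptedChart.isHorizontalOn_iff (h : IsAdaptedChart C eM e A) {γ : ℝ → P} {a b : ℝ}
    (hab : a < b) (hγ : ContMDiffOn 𝓘(ℝ, ℝ) IP 1 γ (Icc a b)) (hs : MapsTo γ (Icc a b) e.source) :
    IsHorizontalOn C (Icc a b) γ ↔ ∀ t ∈ Icc a b, HasDerivWithinAt (fun t => (e (γ t)).2)
        (A (e (γ t)) (derivWithin (fun t => (e (γ t)).1) (Icc a b) t)) (Icc a b) t :=
  ⟨fun h' t ht => (h.horizontal_iff hab ht (hγ.mdifferentiableOn (by simp) t ht) (hs ht)).1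
    (h'.2 t ht), fun h' => ⟨hγ, fun t ht =>
    (h.horizontal_iff hab ht (hγ.mdifferentiableOn (by simp) t ht) (hs ht)).2 (h' t ht)⟩⟩

/-- A lift may fail to be differentiable at a break point, so its velocity is constrained only
between breaks. Both sides of the equation are continuous up to the end points, so it extends there
from the dense open interval. -/
theorem isHorizontalOn_Icc_of_Ioo (hC : HasAdaptedCharts EF C) {γ : ℝ → P} {a b : ℝ}
    (hab : a < b) (hγ : ContMDiffOn 𝓘(ℝ, ℝ) IP 1 γ (Icc a b))
    (h : ∀ t ∈ Ioo a b, C.vert (γ t) (mfderivWithin 𝓘(ℝ, ℝ) IP γ (Icc a b) t (1 : ℝ)) = 0) :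
    IsHorizontalOn C (Icc a b) γ := by
  refine ⟨hγ, fun t₀ ht₀ => ?_⟩
  obtain ⟨eM, e, A, hp, hA⟩ := hC (γ t₀)
  obtain ⟨a', b', hab', ht', hsub, hs, hnhds⟩ := exists_Icc_mem_nhdsWithin ordConnected_Icc
    (nontrivial_Icc_of_lt hab) ht₀ (hγ.continuousOn t₀ ht₀ (e.open_source.mem_nhds hp))
  have hγ' := hγ.mono hsub
  have hmd := hγ.mdifferentiableOn (by simp)
  have hmd' := hγ'.mdifferentiableOn (by simp)
  rw [← mfderivWithin_Icc_of_subset hab' ht' hsub (hmd t₀ ht₀),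
    hA.horizontal_iff hab' ht' (hmd' t₀ ht') (hs ht')]
  have hz := hA.contDiffOn_comp (by simp) hγ' hs
  have hx : ContDiffOn ℝ 1 (fun t => (e (γ t)).1) (Icc a' b') := hz.fst
  have hy : ContDiffOn ℝ 1 (fun t => (e (γ t)).2) (Icc a' b') := hz.snd
  have hu := uniqueDiffOn_Icc hab'
  have hIoo : EqOn (derivWithin (fun t => (e (γ t)).2) (Icc a' b'))
      (fun t => A (e (γ t)) (derivWithin (fun t => (e (γ t)).1) (Icc a' b') t)) (Ioo a' b') := by
    intro t ht
    have htt := Ioo_subset_Icc_self ht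
    refine HasDerivWithinAt.derivWithin ?_ (hu t htt)
    rw [← hA.horizontal_iff hab' htt (hmd' t htt) (hs htt),
      mfderivWithin_Icc_of_subset hab' htt hsub (hmd t (hsub htt))]
    exact h t ⟨(hsub (left_mem_Icc.2 hab'.le)).1.trans_lt ht.1,
      ht.2.trans_le (hsub (right_mem_Icc.2 hab'.le)).2⟩
  have hIcc := hIoo.of_subset_closure (hy.continuousOn_derivWithin hu le_rfl)
    ((hA.contDiffOn_coeff.continuousOn.comp hz.continuousOn fun t ht => e.map_source (hs ht)).clm_apply
      (hx.continuousOn_derivWithin hu le_rfl)) Ioo_subset_Icc_self (closure_Ioo hab'.ne).ge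
  exact (hy.differentiableOn (by simp) t₀ ht').hasDerivWithinAt.congr_deriv (hIcc ht')

/-- The equation is solved for the fibre coordinate and carried back by the chart. By bootstrapping,
the same lift on the same interval serves every `k`. -/
theorem exists_local_horizontal_lift [CompleteSpace EF] (hC : HasAdaptedCharts EF C) {c : ℝ → M}
    {J : Set ℝ} (hJ : J.OrdConnected) (hJ' : J.Nontrivial) (hc : ContMDiffOn 𝓘(ℝ, ℝ) IM 1 c J)
    {t₀ : ℝ} (ht₀ : t₀ ∈ J) {p₀ : P} (hp₀ : π p₀ = c t₀) :
    ∃ a b : ℝ, a < b ∧ t₀ ∈ Icc a b ∧ Icc a b ⊆ J ∧ Icc a b ∈ 𝓝[J] t₀ ∧ ∃ γ : ℝ → P,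
      γ t₀ = p₀ ∧ (∀ t ∈ Icc a b, π (γ t) = c t) ∧ IsHorizontalOn C (Icc a b) γ ∧
      ∀ k : ℕ∞, ContMDiffOn 𝓘(ℝ, ℝ) IM k c J → ContMDiffOn 𝓘(ℝ, ℝ) IP k γ (Icc a b) := by
  obtain ⟨eM, e, A, hp, hA⟩ := hC p₀
  obtain ⟨a₁, b₁, hab₁, ht₁, hsub₁, hs₁, hnhds₁⟩ := exists_Icc_mem_nhdsWithin hJ hJ' ht₀
    (hc.continuousOn t₀ ht₀ (eM.open_source.mem_nhds (hp₀ ▸ hA.proj_mem p₀ hp)))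
  have hxk : ∀ k : ℕ∞, ContMDiffOn 𝓘(ℝ, ℝ) IM k c J →
      ContDiffOn ℝ k (fun t => eM (c t)) (Icc a₁ b₁) := fun k hk =>
    ((hA.contMDiffOn_base.of_le (mod_cast le_top)).comp (hk.mono hsub₁) hs₁).contDiffOn
  have hx : ContDiffOn ℝ 1 (fun t => eM (c t)) (Icc a₁ b₁) := hxk 1 hc
  have hz₀ : e p₀ = (eM (c t₀), (e p₀).2) := Prod.ext (by rw [hA.fst_eq p₀ hp, hp₀]) rfl
  obtain ⟨a, b, hab, ht, hsub, hnhds, y, hy₀, hy⟩ := exists_hasDerivWithinAt_Icc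
    (hA.contDiffOn_coeff.of_le (by simp)) e.open_target ordConnected_Icc
    (nontrivial_Icc_of_lt hab₁) ht₁ hx.continuousOn
    (hx.continuousOn_derivWithin (uniqueDiffOn_Icc hab₁) le_rfl) (y₀ := (e p₀).2)
    (hz₀ ▸ e.map_source hp)
  have hu := uniqueDiffOn_Icc hab
  have hderiv : ∀ t ∈ Icc a b, derivWithin (fun t => eM (c t)) (Icc a₁ b₁) t =
      derivWithin (fun t => eM (c t)) (Icc a b) t := fun t ht =>
    (((hx.differentiableOn (by simp) t (hsub ht)).hasDerivWithinAt.mono hsub).derivWithin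
      (hu t ht)).symm
  have hy' : ∀ t ∈ Icc a b, HasDerivWithinAt y
      (A (eM (c t), y t) (derivWithin (fun t => eM (c t)) (Icc a b) t)) (Icc a b) t :=
    fun t ht => hderiv t ht ▸ (hy t ht).2
  have hγk : ∀ k : ℕ∞, ContMDiffOn 𝓘(ℝ, ℝ) IM k c J →
      ContMDiffOn 𝓘(ℝ, ℝ) IP k (fun t => e.symm (eM (c t), y t)) (Icc a b) := by
    intro k hk
    have hxk' := (hxk k hk).mono hsub
    have hyk := contDiffOn_of_hasDerivWithinAt hu hA.contDiffOn_coeff (fun t ht => (hy t ht).1)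
      hy' hxk'
    exact (hA.contMDiffOn_symm.of_le (mod_cast le_top)).comp (hxk'.prodMk hyk).contMDiffOn
      fun t ht => (hy t ht).1
  have hright : ∀ t ∈ Icc a b, e (e.symm (eM (c t), y t)) = (eM (c t), y t) :=
    fun t ht => e.right_inv (hy t ht).1
  have hmaps : MapsTo (fun t => e.symm (eM (c t), y t)) (Icc a b) e.source :=
    fun t ht => e.map_target (hy t ht).1
  refine ⟨a, b, hab, ht, hsub.trans hsub₁, ?_, fun t => e.symm (eM (c t), y t), ?_, ?_, ?_, hγk⟩
  · exact nhdsWithin_le_of_mem hnhds₁ hnhds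
  · simp only [hy₀, ← hz₀, e.left_inv hp]
  · intro t ht
    refine eM.injOn (hA.proj_mem _ (hmaps ht)) (hs₁ (hsub ht)) ?_
    rw [← hA.fst_eq _ (hmaps ht), hright t ht]
  · refine (hA.isHorizontalOn_iff hab (hγk 1 hc) hmaps).2 fun t ht => ?_
    rw [hright t ht, derivWithin_congr (f := fun t => eM (c t))
      (fun s hs => by rw [hright s hs]) (by rw [hright t ht])]
    exact (hy' t ht).congr (fun s hs => by rw [hright s hs]) (by rw [hright t ht])

theorem IsHorizontalOn.eventuallyEq (hC : HasAdaptedCharts EF C) {γ γ' : ℝ → P} {a b t₀ : ℝ}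
    (hab : a < b) (ht₀ : t₀ ∈ Icc a b) (hγ : IsHorizontalOn C (Icc a b) γ)
    (hγ' : IsHorizontalOn C (Icc a b) γ') (hπ : ∀ t ∈ Icc a b, π (γ t) = π (γ' t))
    (h : γ t₀ = γ' t₀) : ∀ᶠ t in 𝓝[Icc a b] t₀, γ t = γ' t := by
  obtain ⟨eM, e, A, hp, hA⟩ := hC (γ t₀)
  obtain ⟨a', b', hab', ht', hsub, hs, hnhds⟩ := exists_Icc_mem_nhdsWithin ordConnected_Icc
    (nontrivial_Icc_of_lt hab) ht₀
    (inter_mem (hγ.1.continuousOn t₀ ht₀ (e.open_source.mem_nhds hp))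
      (hγ'.1.continuousOn t₀ ht₀ (e.open_source.mem_nhds (h ▸ hp))))
  have hs1 : MapsTo γ (Icc a' b') e.source := fun t ht => (hs ht).1
  have hs2 : MapsTo γ' (Icc a' b') e.source := fun t ht => (hs ht).2
  have hmono := hγ.mono_Icc hab' hsub
  have hmono' := hγ'.mono_Icc hab' hsub
  have hz := hA.contDiffOn_comp (by simp) hmono.1 hs1
  have hx : ContDiffOn ℝ 1 (fun t => (e (γ t)).1) (Icc a' b') := hz.fst
  have hfst : ∀ t ∈ Icc a' b', (e (γ' t)).1 = (e (γ t)).1 := fun t ht => by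
    rw [hA.fst_eq _ (hs1 ht), hA.fst_eq _ (hs2 ht), hπ t (hsub ht)]
  have hy := (hA.isHorizontalOn_iff hab' hmono.1 hs1).1 hmono
  have hy' := (hA.isHorizontalOn_iff hab' hmono'.1 hs2).1 hmono'
  have hev := eventuallyEq_of_hasDerivWithinAt (hA.contDiffOn_coeff.of_le (by simp)) e.open_target
    (x := fun t => (e (γ t)).1) (y := fun t => (e (γ t)).2) (y' := fun t => (e (γ' t)).2)
    ht' hx.continuousOn (hx.continuousOn_derivWithin (uniqueDiffOn_Icc hab') le_rfl)
    (e.map_source hp) hy (fun t ht => by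
      have h3 := hy' t ht
      rw [derivWithin_congr hfst (hfst t ht)] at h3
      rwa [← hfst t ht]) (by simp only [h])
  filter_upwards [nhdsWithin_le_of_mem hnhds hev, hnhds] with t ht1 ht2
  exact e.injOn (hs1 ht2) (hs2 ht2) (Prod.ext (hfst t ht2).symm ht1)

end Lifts

/-! ### Intervals free of break points -/

section Gaps

variable {K S : Set ℝ}

theorem exists_right_gap {t s : ℝ} (hts : t < s) (hfin : (S ∩ Icc t s).Finite) :
    ∃ b, t < b ∧ b ≤ s ∧ Disjoint (Ioo t b) S := by
  have hcl : ((S ∩ Icc t s) \ {t})ᶜ ∈ 𝓝 t :=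
    (hfin.subset sdiff_subset).isClosed.isOpen_compl.mem_nhds fun h => h.2 rfl
  obtain ⟨u, hu, hsub⟩ := (mem_nhdsGE_iff_exists_Ico_subset' hts).1 (mem_nhdsWithin_of_mem_nhds hcl)
  refine ⟨min u s, lt_min hu hts, min_le_right _ _, Set.disjoint_left.2 fun x hx hxS => ?_⟩
  exact hsub ⟨hx.1.le, hx.2.trans_le (min_le_left _ _)⟩
    ⟨⟨hxS, hx.1.le, hx.2.le.trans (min_le_right _ _)⟩, hx.1.ne'⟩

theorem exists_left_gap {t s : ℝ} (hst : s < t) (hfin : (S ∩ Icc s t).Finite) :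
    ∃ a, a < t ∧ s ≤ a ∧ Disjoint (Ioo a t) S := by
  have hcl : ((S ∩ Icc s t) \ {t})ᶜ ∈ 𝓝 t :=
    (hfin.subset sdiff_subset).isClosed.isOpen_compl.mem_nhds fun h => h.2 rfl
  obtain ⟨u, hu, hsub⟩ := (mem_nhdsLE_iff_exists_Ioc_subset' hst).1 (mem_nhdsWithin_of_mem_nhds hcl)
  refine ⟨max u s, max_lt hu hst, le_max_right _ _, Set.disjoint_left.2 fun x hx hxS => ?_⟩
  exact hsub ⟨(le_max_left _ _).trans_lt hx.1, hx.2.le⟩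
    ⟨⟨hxS, (le_max_right _ _).trans hx.1.le, hx.2.le⟩, hx.2.ne⟩

theorem exists_gap (hK : K.OrdConnected) (hK' : K.Nontrivial)
    (hS : ∀ a b : ℝ, Icc a b ⊆ K → (S ∩ Icc a b).Finite) {t : ℝ} (ht : t ∈ K) :
    ∃ a b, a < b ∧ t ∈ Icc a b ∧ Icc a b ⊆ K ∧ Disjoint (Ioo a b) S := by
  obtain ⟨s, hs, hne⟩ := hK'.exists_ne t
  rcases lt_or_gt_of_ne hne with h | h
  · obtain ⟨a, hat, hsa, hd⟩ := exists_left_gap h (hS s t (hK.out hs ht))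
    exact ⟨a, t, hat, right_mem_Icc.2 hat.le, (Icc_subset_Icc_left hsa).trans (hK.out hs ht), hd⟩
  · obtain ⟨b, htb, hbs, hd⟩ := exists_right_gap h (hS t s (hK.out ht hs))
    exact ⟨t, b, htb, left_mem_Icc.2 htb.le, (Icc_subset_Icc_right hbs).trans (hK.out ht hs), hd⟩

end Gaps

/-! ### Piecewise lifts: uniqueness, gluing, global existence -/

section PiecewiseLifts

variable {EF EM HM EP HP : Type*}
  [NormedAddCommGroup EF] [NormedSpace ℝ EF]
  [NormedAddCommGroup EM] [NormedSpace ℝ EM] [TopologicalSpace HM]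
  [NormedAddCommGroup EP] [NormedSpace ℝ EP] [TopologicalSpace HP]
  {IM : ModelWithCorners ℝ EM HM} {IP : ModelWithCorners ℝ EP HP}
  {M : Type*} [TopologicalSpace M] [ChartedSpace HM M]
  {P : Type*} [TopologicalSpace P] [ChartedSpace HP P]
  {π : P → M} [IsManifold IP ∞ P] {C : Connection IP IM π} {K J I : Set ℝ} {c : ℝ → M}
  {γ γ' : ℝ → P}

theorem IsHorizontalOn.congr (h : IsHorizontalOn C K γ) (heq : EqOn γ' γ K) :
    IsHorizontalOn C K γ' := by
  refine ⟨h.1.congr heq, fun t ht => ?_⟩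
  have h1 : (show ℝ →L[ℝ] EP from mfderivWithin 𝓘(ℝ, ℝ) IP γ' K t) =
      mfderivWithin 𝓘(ℝ, ℝ) IP γ K t := mfderivWithin_congr (fun s hs => heq hs) (heq ht)
  have h2 := h.2 t ht
  -- Stated for a family of maps on the model space, since the tangent spaces at `γ t` and `γ' t`
  -- are different types.
  have key : ∀ (V : P → EP →L[ℝ] EP) (L L' : ℝ →L[ℝ] EP), L' = L → V (γ t) (L 1) = 0 →
      V (γ' t) (L' 1) = 0 := by
    rintro V L _ rfl h3
    rw [heq ht, h3]
  exact key (fun q => C.vert q) _ _ h1 h2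

/-- `γ` is a lift of `c` on `K` which is `C¹` and horizontal, up to the end points, on all compact
subintervals without break points inside. -/
structure IsPiecewiseLift (C : Connection IP IM π) (K : Set ℝ) (c : ℝ → M) (γ : ℝ → P) :
    Prop where
  continuousOn : ContinuousOn γ K
  proj_eq : ∀ t ∈ K, π (γ t) = c t
  exists_breaks : ∃ S : Set ℝ, (∀ a b : ℝ, Icc a b ⊆ K → (S ∩ Icc a b).Finite) ∧
    ∀ a b : ℝ, a < b → Icc a b ⊆ K → Disjoint (Ioo a b) S → IsHorizontalOn C (Icc a b) γ

theorem IsPiecewiseLift.mono (h : IsPiecewiseLift C K c γ) (hJ : J ⊆ K) :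
    IsPiecewiseLift C J c γ := by
  obtain ⟨S, hS, hS'⟩ := h.exists_breaks
  exact ⟨h.continuousOn.mono hJ, fun t ht => h.proj_eq t (hJ ht), S,
    fun a b hab => hS a b (hab.trans hJ), fun a b hab hsub => hS' a b hab (hsub.trans hJ)⟩

theorem IsPiecewiseLift.congr (h : IsPiecewiseLift C K c γ) (heq : EqOn γ' γ K) :
    IsPiecewiseLift C K c γ' := by
  obtain ⟨S, hS, hS'⟩ := h.exists_breaks
  exact ⟨h.continuousOn.congr heq, fun t ht => by rw [heq ht, h.proj_eq t ht], S, hS,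
    fun a b hab hsub hd => (hS' a b hab hsub hd).congr (heq.mono hsub)⟩

theorem IsHorizontalOn.isPiecewiseLift (h : IsHorizontalOn C K γ) (hc : ∀ t ∈ K, π (γ t) = c t) :
    IsPiecewiseLift C K c γ :=
  ⟨h.1.continuousOn, hc, ∅, fun a b _ => by simp, fun _ _ hab hsub _ => h.mono_Icc hab hsub⟩

theorem isPiecewiseLift_singleton {t : ℝ} (h : π (γ t) = c t) : IsPiecewiseLift C {t} c γ := by
  refine ⟨continuousOn_singleton _ _, by rintro s rfl; exact h, ∅, fun a b _ => by simp,
    fun a b hab hsub _ => ?_⟩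
  have h1 : a = t := hsub (left_mem_Icc.2 hab.le)
  have h2 : b = t := hsub (right_mem_Icc.2 hab.le)
  exact absurd (h1.trans h2.symm) hab.ne

theorem IsPiecewiseLift.Icc_union {a b d : ℝ} (h₁ : IsPiecewiseLift C (Icc a b) c γ)
    (h₂ : IsPiecewiseLift C (Icc b d) c γ) (hab : a ≤ b) (hbd : b ≤ d) :
    IsPiecewiseLift C (Icc a d) c γ := by
  obtain ⟨S₁, hS₁, hS₁'⟩ := h₁.exists_breaks
  obtain ⟨S₂, hS₂, hS₂'⟩ := h₂.exists_breaks
  -- Each break set is locally finite only within its own interval, hence is cut down to it; the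
  -- junction `b` is a new break.
  refine ⟨?_, fun t ht => ?_, (S₁ ∩ Icc a b) ∪ (S₂ ∩ Icc b d) ∪ {b}, fun r s _ => ?_,
    fun r s hrs hsub hd => ?_⟩
  · rw [← Icc_union_Icc_eq_Icc hab hbd]
    exact h₁.continuousOn.union_of_isClosed h₂.continuousOn isClosed_Icc isClosed_Icc
  · rcases le_total t b with h | h
    · exact h₁.proj_eq t ⟨ht.1, h⟩
    · exact h₂.proj_eq t ⟨h, ht.2⟩
  · exact (((hS₁ a b subset_rfl).union (hS₂ b d subset_rfl)).union
      (finite_singleton b)).subset inter_subset_left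
  · have hr := hsub (left_mem_Icc.2 hrs.le)
    have hs := hsub (right_mem_Icc.2 hrs.le)
    rw [disjoint_union_right, disjoint_union_right, disjoint_singleton_right] at hd
    rcases le_or_gt s b with h | h
    · have hsub' : Icc r s ⊆ Icc a b := Icc_subset_Icc hr.1 h
      exact hS₁' r s hrs hsub' (Set.disjoint_left.2 fun x hx hxS =>
        Set.disjoint_left.1 hd.1.1 hx ⟨hxS, hsub' (Ioo_subset_Icc_self hx)⟩)
    · have hbr : b ≤ r := not_lt.1 fun h' => hd.2 ⟨h', h⟩
      have hsub' : Icc r s ⊆ Icc b d := Icc_subset_Icc hbr hs.2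
      exact hS₂' r s hrs hsub' (Set.disjoint_left.2 fun x hx hxS =>
        Set.disjoint_left.1 hd.1.2 hx ⟨hxS, hsub' (Ioo_subset_Icc_self hx)⟩)

theorem IsPiecewiseLift.exists_glue {a b d : ℝ} (h₁ : IsPiecewiseLift C (Icc a b) c γ)
    (h₂ : IsPiecewiseLift C (Icc b d) c γ') (hab : a ≤ b) (hbd : b ≤ d) (h : γ b = γ' b) :
    ∃ η, IsPiecewiseLift C (Icc a d) c η := by
  refine ⟨fun t => if t ≤ b then γ t else γ' t,
    IsPiecewiseLift.Icc_union (h₁.congr fun t ht => if_pos ht.2) (h₂.congr fun t ht => ?_) hab hbd⟩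
  rcases ht.1.eq_or_lt with rfl | hlt
  · simpa using h
  · exact if_neg hlt.not_ge

theorem Connection.IsHorizontalLift.isPiecewiseLift (hC : HasAdaptedCharts EF C)
    (h : C.IsHorizontalLift K c γ) : IsPiecewiseLift C K c γ := by
  obtain ⟨hcont, S, hS, hS'⟩ := h.isPiecewiseC1On
  refine ⟨hcont, h.proj_eq, S, hS, fun a b hab hsub hd => ?_⟩
  refine isHorizontalOn_Icc_of_Ioo hC hab (hS' a b hab hsub hd) fun t ht => ?_
  have hn : Icc a b ∈ 𝓝 t := Icc_mem_nhds ht.1 ht.2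
  have htt := Ioo_subset_Icc_self ht
  have hmd := (((hS' a b hab hsub hd).mdifferentiableOn (by simp)) t htt).mdifferentiableAt hn
  rw [mfderivWithin_Icc_of_subset hab htt hsub hmd.mdifferentiableWithinAt]
  exact h.velocity_mem t (hsub htt) hmd.mdifferentiableWithinAt

/-- Wherever the velocity exists, it equals the one-sided velocity of an adjacent break-free piece,
which is horizontal. -/
theorem IsPiecewiseLift.isHorizontalLift (hK : K.OrdConnected) (hK' : K.Nontrivial)
    (h : IsPiecewiseLift C K c γ) : C.IsHorizontalLift K c γ := by
  obtain ⟨S, hS, hS'⟩ := h.exists_breaks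
  refine ⟨⟨h.continuousOn, S, hS, fun a b hab hsub hd => (hS' a b hab hsub hd).1⟩, h.proj_eq,
    fun t ht hmd => ?_⟩
  obtain ⟨a, b, hab, htab, hsub, hd⟩ := exists_gap hK hK' hS ht
  rw [← mfderivWithin_Icc_of_subset hab htab hsub hmd]
  exact (hS' a b hab hsub hd).2 t htab

theorem IsPiecewiseLift.eventuallyEq (hC : HasAdaptedCharts EF C) (hK : K.OrdConnected)
    (h : IsPiecewiseLift C K c γ) (h' : IsPiecewiseLift C K c γ') {t₀ : ℝ} (ht₀ : t₀ ∈ K)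
    (heq : γ t₀ = γ' t₀) : ∀ᶠ t in 𝓝[K] t₀, γ t = γ' t := by
  obtain ⟨S, hS, hSh⟩ := h.exists_breaks
  obtain ⟨S', hS', hSh'⟩ := h'.exists_breaks
  have hfin : ∀ a b : ℝ, Icc a b ⊆ K → ((S ∪ S') ∩ Icc a b).Finite := fun a b hab => by
    rw [union_inter_distrib_right]
    exact (hS a b hab).union (hS' a b hab)
  have hloc : ∀ a b : ℝ, a < b → t₀ ∈ Icc a b → Icc a b ⊆ K → Disjoint (Ioo a b) (S ∪ S') →
      ∀ᶠ t in 𝓝 t₀, t ∈ Icc a b → γ t = γ' t := fun a b hab ht hsub hd => by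
    rw [disjoint_union_right] at hd
    exact eventually_nhdsWithin_iff.1 (IsHorizontalOn.eventuallyEq hC hab ht
      (hSh a b hab hsub hd.1) (hSh' a b hab hsub hd.2)
      (fun t ht => by rw [h.proj_eq t (hsub ht), h'.proj_eq t (hsub ht)]) heq)
  have hright : ∀ᶠ t in 𝓝[K] t₀, t₀ < t → γ t = γ' t := by
    by_cases hex : ∃ s ∈ K, t₀ < s
    · obtain ⟨s, hs, hts⟩ := hex
      have hsub := hK.out ht₀ hs
      obtain ⟨b, htb, hbs, hd⟩ := exists_right_gap hts (hfin _ _ hsub)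
      filter_upwards [mem_nhdsWithin_of_mem_nhds (hloc t₀ b htb (left_mem_Icc.2 htb.le)
        ((Icc_subset_Icc_right hbs).trans hsub) hd),
        mem_nhdsWithin_of_mem_nhds (Iio_mem_nhds htb)] with t h1 h2 h3
      exact h1 ⟨h3.le, le_of_lt h2⟩
    · filter_upwards [self_mem_nhdsWithin] with t ht hlt
      exact (hex ⟨t, ht, hlt⟩).elim
  have hleft : ∀ᶠ t in 𝓝[K] t₀, t < t₀ → γ t = γ' t := by
    by_cases hex : ∃ s ∈ K, s < t₀
    · obtain ⟨s, hs, hst⟩ := hex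
      have hsub := hK.out hs ht₀
      obtain ⟨a, hat, hsa, hd⟩ := exists_left_gap hst (hfin _ _ hsub)
      filter_upwards [mem_nhdsWithin_of_mem_nhds (hloc a t₀ hat (right_mem_Icc.2 hat.le)
        ((Icc_subset_Icc_left hsa).trans hsub) hd),
        mem_nhdsWithin_of_mem_nhds (Ioi_mem_nhds hat)] with t h1 h2 h3
      exact h1 ⟨le_of_lt h2, h3.le⟩
    · filter_upwards [self_mem_nhdsWithin] with t ht hlt
      exact (hex ⟨t, ht, hlt⟩).elim
  filter_upwards [hright, hleft] with t h1 h2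
  rcases lt_trichotomy t t₀ with hlt | rfl | hlt
  exacts [h2 hlt, heq, h1 hlt]

/-- The set of agreement is closed because `P` is Hausdorff and open by local uniqueness, and `K` is
connected. -/
theorem IsPiecewiseLift.eqOn [T2Space P] (hC : HasAdaptedCharts EF C) (hK : K.OrdConnected)
    (h : IsPiecewiseLift C K c γ) (h' : IsPiecewiseLift C K c γ') {t₀ : ℝ} (ht₀ : t₀ ∈ K)
    (heq : γ t₀ = γ' t₀) : EqOn γ γ' K := by
  have hpre : PreconnectedSpace K := isPreconnected_iff_preconnectedSpace.1 hK.isPreconnected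
  have hclopen : IsClopen {t : K | γ t = γ' t} := by
    refine ⟨isClosed_eq (continuousOn_iff_continuous_domRestrict.1 h.continuousOn)
      (continuousOn_iff_continuous_domRestrict.1 h'.continuousOn), isOpen_iff_mem_nhds.2 ?_⟩
    rintro ⟨t, ht⟩ hteq
    exact mem_nhds_subtype_iff_nhdsWithin.2 <| by
      filter_upwards [h.eventuallyEq hC hK h' ht hteq, self_mem_nhdsWithin] with s hs hsK
      exact ⟨⟨s, hsK⟩, hs, rfl⟩
  intro t ht
  have huniv := hclopen.eq_univ ⟨⟨t₀, ht₀⟩, heq⟩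
  exact (huniv ▸ mem_univ (⟨t, ht⟩ : K) : (⟨t, ht⟩ : K) ∈ {t : K | γ t = γ' t})

/-- By uniqueness the lift agrees near each point of `J` with a local `C^k` lift, so any declared
breaks there are spurious. -/
theorem IsPiecewiseLift.contMDiffOn [T2Space P] [CompleteSpace EF] (hC : HasAdaptedCharts EF C)
    (h : IsPiecewiseLift C K c γ) (hJK : J ⊆ K) (hJ : J.OrdConnected) (hJ' : J.Nontrivial)
    {k : ℕ∞} (hk : 1 ≤ k) (hc : ContMDiffOn 𝓘(ℝ, ℝ) IM k c J) :
    ContMDiffOn 𝓘(ℝ, ℝ) IP k γ J := by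
  intro t ht
  obtain ⟨a, b, hab, htab, hsub, hnhds, η, hη, hπη, hηh, hηk⟩ := exists_local_horizontal_lift hC
    hJ hJ' (hc.of_le (mod_cast hk)) ht (h.proj_eq t (hJK ht))
  have heq := (h.mono (hsub.trans hJK)).eqOn hC ordConnected_Icc (hηh.isPiecewiseLift hπη) htab
    hη.symm
  exact (((hηk k hc).congr heq) t htab).mono_of_mem_nhdsWithin hnhds

theorem IsPiecewiseLift.isHorizontalOn [T2Space P] [CompleteSpace EF]
    (hC : HasAdaptedCharts EF C) (h : IsPiecewiseLift C K c γ) (hJK : J ⊆ K)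
    (hJ : J.OrdConnected) (hJ' : J.Nontrivial) (hc : ContMDiffOn 𝓘(ℝ, ℝ) IM 1 c J) :
    IsHorizontalOn C J γ := by
  have hγ := h.contMDiffOn hC hJK hJ hJ' (k := 1) le_rfl hc
  exact ⟨hγ, fun t ht => ((h.mono hJK).isHorizontalLift hJ hJ').velocity_mem t ht
    (hγ.mdifferentiableOn (by simp) t ht)⟩

theorem IsHorizontalOn.comp_Icc (h : IsHorizontalOn C K γ) {φ : ℝ → ℝ} {a b : ℝ} (hab : a < b)
    (hφ : ContDiffOn ℝ 1 φ (Icc a b)) (hmaps : MapsTo φ (Icc a b) K) :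
    IsHorizontalOn C (Icc a b) (γ ∘ φ) := by
  refine ⟨h.1.comp hφ.contMDiffOn hmaps, fun s hs => ?_⟩
  have hd := ((h.1.mdifferentiableOn (by simp) _ (hmaps hs)).hasMFDerivWithinAt.comp s
    ((hφ.contMDiffOn.mdifferentiableOn (by simp)) s hs).hasMFDerivWithinAt hmaps).mfderivWithin
    ((uniqueDiffOn_Icc hab).uniqueMDiffOn s hs)
  -- The new velocity is the old one times `r = φ'(s)`; no sign or nonvanishing of `r` matters.
  have key : ∀ (V : EP →L[ℝ] EP) (L : ℝ →L[ℝ] EP) (r : ℝ), V (L 1) = 0 → V (L r) = 0 := by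
    intro V L r h0
    rw [← mul_one r, ← smul_eq_mul, map_smul, map_smul, h0, smul_zero]
  rw [hd]
  exact key (C.vert (γ (φ s))) (mfderivWithin 𝓘(ℝ, ℝ) IP γ K (φ s)) _ (h.2 _ (hmaps hs))

/-- Piecewise horizontal lifts can be moved so as to pass through any given point over the curve. -/
def HasTransitiveLifts (C : Connection IP IM π) : Prop :=
  ∀ (K : Set ℝ) (c : ℝ → M) (γ : ℝ → P), IsPiecewiseLift C K c γ → ∀ t ∈ K, ∀ p, π p = c t →
    ∃ γ', IsPiecewiseLift C K c γ' ∧ γ' t = p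

theorem exists_isPiecewiseLift_right [CompleteSpace EF] (hC : HasAdaptedCharts EF C)
    (hsurj : Function.Surjective π) (hc : IsPiecewiseC1On IM I c) {a b : ℝ} (hab : a < b)
    (hsub : Icc a b ⊆ I) : ∃ r > a, r ≤ b ∧ ∃ γ, IsPiecewiseLift C (Icc a r) c γ := by
  obtain ⟨-, S, hS, hS'⟩ := hc
  obtain ⟨d, had, hdb, hd⟩ := exists_right_gap hab (hS a b hsub)
  obtain ⟨p, hp⟩ := hsurj (c a)
  obtain ⟨a', b', hab', ha, hsub', -, γ, -, hπ, hγ, -⟩ := exists_local_horizontal_lift hC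
    ordConnected_Icc (nontrivial_Icc_of_lt had)
    (hS' a d had ((Icc_subset_Icc_right hdb).trans hsub) hd) (left_mem_Icc.2 had.le) hp
  have haa : a' = a := le_antisymm ha.1 (hsub' (left_mem_Icc.2 hab'.le)).1
  subst haa
  exact ⟨b', hab', (hsub' (right_mem_Icc.2 hab'.le)).2.trans hdb, γ, hγ.isPiecewiseLift hπ⟩

theorem exists_isPiecewiseLift_left [CompleteSpace EF] (hC : HasAdaptedCharts EF C)
    (hsurj : Function.Surjective π) (hc : IsPiecewiseC1On IM I c) {a b : ℝ} (hab : a < b)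
    (hsub : Icc a b ⊆ I) : ∃ l < b, a ≤ l ∧ ∃ γ, IsPiecewiseLift C (Icc l b) c γ := by
  obtain ⟨-, S, hS, hS'⟩ := hc
  obtain ⟨d, hdb, had, hd⟩ := exists_left_gap hab (hS a b hsub)
  obtain ⟨p, hp⟩ := hsurj (c b)
  obtain ⟨a', b', hab', hb, hsub', -, γ, -, hπ, hγ, -⟩ := exists_local_horizontal_lift hC
    ordConnected_Icc (nontrivial_Icc_of_lt hdb)
    (hS' d b hdb ((Icc_subset_Icc_left had).trans hsub) hd) (right_mem_Icc.2 hdb.le) hp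
  have hbb : b' = b := le_antisymm (hsub' (right_mem_Icc.2 hab'.le)).2 hb.2
  subst hbb
  exact ⟨a', hab', had.trans (hsub' (left_mem_Icc.2 hab'.le)).1, γ, hγ.isPiecewiseLift hπ⟩

/-- The second lift is moved to start at the end of the first. Conditional hypotheses let degenerate
subintervals contribute nothing. -/
theorem exists_isPiecewiseLift_trans (hT : HasTransitiveLifts C) {r s t : ℝ}
    (hrs : r ≤ s) (hst : s ≤ t) (h₁ : r < s → ∃ γ, IsPiecewiseLift C (Icc r s) c γ)
    (h₂ : s < t → ∃ γ, IsPiecewiseLift C (Icc s t) c γ) :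
    r < t → ∃ γ, IsPiecewiseLift C (Icc r t) c γ := by
  intro hrt
  rcases hrs.eq_or_lt with rfl | hrs'
  · exact h₂ hrt
  rcases hst.eq_or_lt with rfl | hst'
  · exact h₁ hrt
  obtain ⟨γ₁, hγ₁⟩ := h₁ hrs'
  obtain ⟨γ₂, hγ₂⟩ := h₂ hst'
  obtain ⟨γ₃, hγ₃, heq⟩ := hT _ _ _ hγ₂ s (left_mem_Icc.2 hst) (γ₁ s)
    (hγ₁.proj_eq s (right_mem_Icc.2 hrs))
  exact hγ₁.exists_glue hγ₃ hrs hst heq.symm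

/-- Near each time, every short subinterval carries some lift; a break at that time is handled by
joining its two sides. Compactness yields a finite subdivision, and the pieces are joined by
induction. Starting points need no control. -/
theorem exists_isPiecewiseLift_Icc [CompleteSpace EF] (hC : HasAdaptedCharts EF C)
    (hT : HasTransitiveLifts C) (hsurj : Function.Surjective π) (hc : IsPiecewiseC1On IM I c)
    {a b : ℝ} (hab : a < b) (hsub : Icc a b ⊆ I) : ∃ γ, IsPiecewiseLift C (Icc a b) c γ := by
  have hlocal : ∀ t₀ ∈ Icc a b, ∃ l r : ℝ, l < t₀ ∧ t₀ < r ∧ ∀ s t, a ≤ s → t ≤ b → l < s → t < r →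
      s < t → ∃ γ, IsPiecewiseLift C (Icc s t) c γ := by
    intro t₀ ht₀
    obtain ⟨r, hr, hr'⟩ : ∃ r > t₀, ∀ s t, t₀ ≤ s → t ≤ b → t < r → s < t →
        ∃ γ, IsPiecewiseLift C (Icc s t) c γ := by
      rcases ht₀.2.eq_or_lt with rfl | hlt
      · exact ⟨t₀ + 1, by linarith, fun s t h1 h2 _ h3 => absurd (h3.trans_le h2) h1.not_gt⟩
      · obtain ⟨r, hr, -, γ, hγ⟩ := exists_isPiecewiseLift_right hC hsurj hc hlt
          ((Icc_subset_Icc_left ht₀.1).trans hsub)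
        exact ⟨r, hr, fun s t h1 _ h2 _ => ⟨γ, hγ.mono (Icc_subset_Icc h1 h2.le)⟩⟩
    obtain ⟨l, hl, hl'⟩ : ∃ l < t₀, ∀ s t, t ≤ t₀ → a ≤ s → l < s → s < t →
        ∃ γ, IsPiecewiseLift C (Icc s t) c γ := by
      rcases ht₀.1.eq_or_lt with rfl | hlt
      · exact ⟨a - 1, by linarith, fun s t h1 h2 _ h3 => absurd (h3.trans_le h1) h2.not_gt⟩
      · obtain ⟨l, hl, -, γ, hγ⟩ := exists_isPiecewiseLift_left hC hsurj hc hlt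
          ((Icc_subset_Icc_right ht₀.2).trans hsub)
        exact ⟨l, hl, fun s t h1 _ h2 _ => ⟨γ, hγ.mono (Icc_subset_Icc h2.le h1)⟩⟩
    refine ⟨l, r, hl, hr, fun s t has htb hls htr hst => ?_⟩
    rcases le_total t t₀ with h | h
    · exact hl' s t h has hls hst
    rcases le_total t₀ s with h' | h'
    · exact hr' s t h' htb htr hst
    exact exists_isPiecewiseLift_trans hT h' h (hl' s t₀ le_rfl has hls)
      (hr' t₀ t le_rfl htb htr) hst
  choose! l r hl hr hlr using hlocal
  obtain ⟨t, ht0, hmono, ⟨m, hm⟩, hcov⟩ := exists_monotone_Icc_subset_open_cover_Icc hab.le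
    (c := fun i : Icc a b => {x : Icc a b | l i < x ∧ (x : ℝ) < r i})
    (fun i => (isOpen_lt continuous_const continuous_subtype_val).inter
      (isOpen_lt continuous_subtype_val continuous_const))
    (fun x _ => mem_iUnion.2 ⟨x, hl x x.2, hr x x.2⟩)
  have hind : ∀ n, a < t n → ∃ γ, IsPiecewiseLift C (Icc a (t n : ℝ)) c γ := by
    intro n
    induction n with
    | zero => intro h; rw [ht0] at h; exact absurd h (lt_irrefl a)
    | succ n ih =>
      have hle : t n ≤ t (n + 1) := hmono n.le_succ
      obtain ⟨i, hi⟩ := hcov n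
      exact exists_isPiecewiseLift_trans hT (t n).2.1 hle ih fun hlt =>
        hlr i i.2 _ _ (t n).2.1 (t (n + 1)).2.2 (hi (left_mem_Icc.2 hle)).1
          (hi (right_mem_Icc.2 hle)).2 hlt
  have := hind m
  rw [hm m le_rfl] at this
  exact this hab

theorem exists_isPiecewiseLift [T2Space P] [CompleteSpace EF] (hC : HasAdaptedCharts EF C)
    (hT : HasTransitiveLifts C) (hsurj : Function.Surjective π) (hc : IsPiecewiseC1On IM I c)
    (hI : I.OrdConnected) (hI' : I.Nontrivial) {t₀ : ℝ} (ht₀ : t₀ ∈ I) {p₀ : P}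
    (hp₀ : π p₀ = c t₀) : ∃ γ, IsPiecewiseLift C I c γ ∧ γ t₀ = p₀ := by
  have hcompact : ∀ a b : ℝ, t₀ ∈ Icc a b → Icc a b ⊆ I →
      ∃ γ, IsPiecewiseLift C (Icc a b) c γ ∧ γ t₀ = p₀ := by
    intro a b ht hsub
    rcases (ht.1.trans ht.2).eq_or_lt with rfl | hab
    · have : t₀ = a := le_antisymm ht.2 ht.1
      subst this
      exact ⟨fun _ => p₀, by rw [Icc_self]; exact isPiecewiseLift_singleton hp₀, rfl⟩
    · obtain ⟨γ, hγ⟩ := exists_isPiecewiseLift_Icc hC hT hsurj hc hab hsub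
      exact hT _ _ _ hγ t₀ ht p₀ hp₀
  have hmem : ∀ t : ℝ, t₀ ∈ Icc (min t₀ t) (max t₀ t) := fun t => ⟨min_le_left _ _, le_max_left _ _⟩
  have hsubI : ∀ t ∈ I, Icc (min t₀ t) (max t₀ t) ⊆ I := fun t ht => hI.uIcc_subset ht₀ ht
  have : Nonempty P := ⟨p₀⟩
  -- `L t` is the lift through `p₀` on the interval between `t₀` and `t`; the global lift is the
  -- diagonal `t ↦ L t t`.
  choose! L hL hL₀ using fun t (ht : t ∈ I) => hcompact _ _ (hmem t) (hsubI t ht)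
  have hagree : ∀ a b : ℝ, t₀ ∈ Icc a b → Icc a b ⊆ I → ∃ γ, IsPiecewiseLift C (Icc a b) c γ ∧
      EqOn (fun t => L t t) γ (Icc a b) := by
    intro a b ht hsub
    obtain ⟨γ, hγ, hγ₀⟩ := hcompact a b ht hsub
    refine ⟨γ, hγ, fun t htab => ?_⟩
    have htI := hsub htab
    exact (hL t htI).eqOn hC ordConnected_Icc
      (hγ.mono (Icc_subset_Icc (le_min ht.1 htab.1) (max_le ht.2 htab.2))) (hmem t)
      ((hL₀ t htI).trans hγ₀.symm) ⟨min_le_right _ _, le_max_right _ _⟩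
  have hagree' : ∀ a b : ℝ, a < b → Icc a b ⊆ I →
      ∃ γ, IsPiecewiseLift C (Icc a b) c γ ∧ EqOn (fun t => L t t) γ (Icc a b) := by
    intro a b hab hsub
    have ha := hsub (left_mem_Icc.2 hab.le)
    have hb := hsub (right_mem_Icc.2 hab.le)
    have hsub' : Icc a b ⊆ Icc (min a t₀) (max b t₀) :=
      Icc_subset_Icc (min_le_left _ _) (le_max_left _ _)
    have h1 : min a t₀ ∈ I := by rcases min_choice a t₀ with h | h <;> rw [h] <;> assumption
    have h2 : max b t₀ ∈ I := by rcases max_choice b t₀ with h | h <;> rw [h] <;> assumption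
    obtain ⟨γ, hγ, heq⟩ := hagree (min a t₀) (max b t₀) ⟨min_le_right _ _, le_max_right _ _⟩
      (hI.out h1 h2)
    exact ⟨γ, hγ.mono hsub', heq.mono hsub'⟩
  obtain ⟨-, S, hS, hS'⟩ := hc
  -- The breaks of `c` serve for the lift: those of the individual lifts vary with the compact
  -- interval and need not be locally finite together.
  refine ⟨fun t => L t t, ⟨fun t ht => ?_, fun t ht => ?_, S, hS, fun a b hab hsub hd => ?_⟩,
    hL₀ t₀ ht₀⟩
  · obtain ⟨a, b, hab, htab, hsub, -, hnhds⟩ := exists_Icc_mem_nhdsWithin hI hI' ht univ_mem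
    obtain ⟨γ, hγ, heq⟩ := hagree' a b hab hsub
    exact ((hγ.continuousOn.congr heq) t htab).mono_of_mem_nhdsWithin hnhds
  · exact (hL t ht).proj_eq t ⟨min_le_right _ _, le_max_right _ _⟩
  · obtain ⟨γ, hγ, heq⟩ := hagree' a b hab hsub
    exact (hγ.isHorizontalOn hC subset_rfl ordConnected_Icc
      (nontrivial_Icc_of_lt hab) (hS' a b hab hsub hd)).congr heq

end PiecewiseLifts

/-! ### The group action moves horizontal lifts -/

section Principal

variable {EG HG EM HM EP HP : Type*}
  [NormedAddCommGroup EG] [NormedSpace ℝ EG] [TopologicalSpace HG]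
  [NormedAddCommGroup EM] [NormedSpace ℝ EM] [TopologicalSpace HM]
  [NormedAddCommGroup EP] [NormedSpace ℝ EP] [TopologicalSpace HP]
  {IG : ModelWithCorners ℝ EG HG} {IM : ModelWithCorners ℝ EM HM} {IP : ModelWithCorners ℝ EP HP}
  {G : Type*} [Group G] [TopologicalSpace G] [ChartedSpace HG G]
  {M : Type*} [TopologicalSpace M] [ChartedSpace HM M]
  {P : Type*} [TopologicalSpace P] [ChartedSpace HP P]

theorem PrincipalBundle.proj_surjective (B : PrincipalBundle IG IM IP G M P) :
    Function.Surjective B.proj := by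
  intro m
  obtain ⟨U, ψ, -, hm, -, ht, hfst, -⟩ := B.exists_trivialisation m
  have hmem : (m, (1 : G)) ∈ ψ.target := by rw [ht]; exact ⟨hm, mem_univ _⟩
  refine ⟨ψ.symm (m, 1), ?_⟩
  rw [← hfst _ (ψ.map_target hmem), ψ.right_inv hmem]

theorem PrincipalBundle.exists_act_eq (B : PrincipalBundle IG IM IP G M P) {p q : P}
    (h : B.proj p = B.proj q) : ∃ g, B.act p g = q := by
  obtain ⟨U, ψ, -, hm, hs, -, hfst, hact, -⟩ := B.exists_trivialisation (B.proj p)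
  have hp : p ∈ ψ.source := by rw [hs]; exact hm
  have hq : q ∈ ψ.source := by rw [hs, mem_preimage, ← h]; exact hm
  refine ⟨(ψ p).2⁻¹ * (ψ q).2, ψ.injOn ?_ hq ?_⟩
  · rw [hs, mem_preimage, B.proj_act]; exact hm
  · rw [hact p hp, mul_inv_cancel_left, hfst p hp, h, ← hfst q hq]

theorem PrincipalBundle.contMDiff_act_right (B : PrincipalBundle IG IM IP G M P) (g : G) :
    ContMDiff IP IP ∞ (fun p => B.act p g) :=
  B.contMDiff_act.comp (contMDiff_id.prodMk contMDiff_const)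

variable [IsManifold IP ∞ P] {B : PrincipalBundle IG IM IP G M P} {C : Connection IP IM B.proj}
  {K : Set ℝ} {c : ℝ → M} {γ : ℝ → P}

/-- `P_V (Tρ_g v) = Tρ_g (P_V v) = 0` for horizontal `v`. -/
theorem IsHorizontalOn.act (hC : C.IsPrincipal) {a b : ℝ} (hab : a < b)
    (h : IsHorizontalOn C (Icc a b) γ) (g : G) :
    IsHorizontalOn C (Icc a b) (fun t => B.act (γ t) g) := by
  refine ⟨((B.contMDiff_act_right g).of_le (by simp)).comp_contMDiffOn h.1, fun t ht => ?_⟩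
  have hd := ((((B.contMDiff_act_right g) (γ t)).mdifferentiableAt
    (by simp)).hasMFDerivAt.comp_hasMFDerivWithinAt t
    (h.1.mdifferentiableOn (by simp) t ht).hasMFDerivWithinAt).mfderivWithin
      ((uniqueDiffOn_Icc hab).uniqueMDiffOn t ht)
  have h1 := hC g (γ t) (mfderivWithin 𝓘(ℝ, ℝ) IP γ (Icc a b) t (1 : ℝ))
  rw [h.2 t ht, map_zero] at h1
  rw [← h1]
  exact congrArg (fun L => C.vert (B.act (γ t) g) (L (1 : ℝ))) hd

theorem IsPiecewiseLift.act (hC : C.IsPrincipal) (h : IsPiecewiseLift C K c γ) (g : G) :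
    IsPiecewiseLift C K c (fun t => B.act (γ t) g) := by
  obtain ⟨S, hS, hS'⟩ := h.exists_breaks
  exact ⟨(B.contMDiff_act_right g).continuous.comp_continuousOn h.continuousOn,
    fun t ht => by rw [B.proj_act, h.proj_eq t ht], S, hS,
    fun a b hab hsub hd => (hS' a b hab hsub hd).act hC hab g⟩

theorem hasTransitiveLifts (hC : C.IsPrincipal) : HasTransitiveLifts C := by
  intro K c γ h t ht p hp
  obtain ⟨g, hg⟩ := B.exists_act_eq ((h.proj_eq t ht).trans hp.symm)
  exact ⟨_, h.act hC g, hg⟩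

end Principal

end PrincipalConnection

/-! ### Parallel transport from a single lift -/

open PrincipalConnection Set in
theorem mainTheorem6
    {EG HG EM HM EP HP : Type*}
    [NormedAddCommGroup EG] [NormedSpace ℝ EG] [FiniteDimensional ℝ EG] [TopologicalSpace HG]
    [NormedAddCommGroup EM] [NormedSpace ℝ EM] [FiniteDimensional ℝ EM] [TopologicalSpace HM]
    [NormedAddCommGroup EP] [NormedSpace ℝ EP] [FiniteDimensional ℝ EP] [TopologicalSpace HP]
    (IG : ModelWithCorners ℝ EG HG) (IM : ModelWithCorners ℝ EM HM)
    (IP : ModelWithCorners ℝ EP HP)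
    {G : Type*} [Group G] [TopologicalSpace G] [ChartedSpace HG G] [LieGroup IG ∞ G]
    [BoundarylessManifold IG G] [T2Space G] [SecondCountableTopology G]
    {M : Type*} [TopologicalSpace M] [ChartedSpace HM M] [IsManifold IM ∞ M]
    [BoundarylessManifold IM M] [T2Space M] [SecondCountableTopology M]
    {P : Type*} [TopologicalSpace P] [ChartedSpace HP P] [IsManifold IP ∞ P]
    [BoundarylessManifold IP P] [T2Space P] [SecondCountableTopology P]
    (B : PrincipalConnection.PrincipalBundle IG IM IP G M P)
    (C : PrincipalConnection.Connection IP IM B.proj) (hC : C.IsPrincipal)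
    (I : Set ℝ) (hI : I.OrdConnected) (hI' : I.Nontrivial) (h0 : (0 : ℝ) ∈ I)
    (c : ℝ → M) (hc : PrincipalConnection.IsPiecewiseC1On IM I c) :
    ∃ T : P → ℝ → P,
      -- parallel transport is defined on the whole fibre and for all times
      C.IsParallelTransport I c T ∧
      -- it is the only one
      (∀ γ : ℝ → P, C.IsHorizontalLift I c γ → Set.EqOn γ (T (γ 0)) I) ∧
      -- it is continuous, and of class `C^k` wherever the curve is
      ContinuousOn (fun x : P × ℝ => T x.1 x.2) ((B.proj ⁻¹' {c 0}) ×ˢ I) ∧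
      (∀ k : ℕ∞, 1 ≤ k → ∀ J : Set ℝ, J ⊆ I → J.OrdConnected → J.Nontrivial →
        ContMDiffOn 𝓘(ℝ, ℝ) IM k c J →
        ContMDiffOn (IP.prod 𝓘(ℝ, ℝ)) IP k (fun x : P × ℝ => T x.1 x.2)
          ((B.proj ⁻¹' {c 0}) ×ˢ J)) ∧
      -- it depends smoothly on the starting point
      (∀ t ∈ I, ContMDiffOn IP IP ∞ (fun p => T p t) (B.proj ⁻¹' {c 0})) ∧
      -- it is invariant under reparametrisation
      (ContMDiffOn 𝓘(ℝ, ℝ) IM 1 c I →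
        ∀ (J : Set ℝ) (φ : ℝ → ℝ), J.OrdConnected → J.Nontrivial → (0 : ℝ) ∈ J →
          ContDiffOn ℝ 1 φ J → Set.MapsTo φ J I →
          ∀ T' : P → ℝ → P, C.IsParallelTransport J (c ∘ φ) T' →
            ∀ p, B.proj p = c 0 → ∀ s ∈ J, T p (φ s) = T' (T p (φ 0)) s) := by
  have hch : HasAdaptedCharts EG C := fun p => exists_isAdaptedChart C p
  have : CompleteSpace EG := FiniteDimensional.complete ℝ EG
  obtain ⟨U, ψ, -, hm, hs, ht, hfst, hact, hψ, -⟩ := B.exists_trivialisation (c 0)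
  have hmem : (c 0, (1 : G)) ∈ ψ.target := by rw [ht]; exact ⟨hm, mem_univ _⟩
  have hfib : ∀ p, B.proj p = c 0 → p ∈ ψ.source := fun p hp => by
    rw [hs, mem_preimage, hp]; exact hm
  have hp₀ : B.proj (ψ.symm (c 0, 1)) = c 0 := by
    rw [← hfst _ (ψ.map_target hmem), ψ.right_inv hmem]
  -- Starting `γ` at the point with fibre coordinate `1` makes `(ψ p).2` exactly the group element
  -- carrying `γ 0` to `p`.
  obtain ⟨γ, hγ, hγ₀⟩ := exists_isPiecewiseLift hch (hasTransitiveLifts hC) B.proj_surjective hc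
    hI hI' h0 hp₀
  have hT : ∀ p, IsPiecewiseLift C I c (fun t => B.act (γ t) (ψ p).2) := fun p => hγ.act hC _
  have hT₀ : ∀ p, B.proj p = c 0 → B.act (γ 0) (ψ p).2 = p := fun p hp => by
    have hsrc := ψ.map_target hmem
    rw [hγ₀]
    refine ψ.injOn ?_ (hfib p hp) ?_
    · exact hfib _ (by rw [B.proj_act, hp₀])
    · rw [hact _ hsrc, ψ.right_inv hmem, one_mul, ← hp, ← hfst p (hfib p hp)]
  have hψF : ContMDiffOn IP IG ∞ (fun p => (ψ p).2) (B.proj ⁻¹' {c 0}) :=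
    contMDiff_snd.comp_contMDiffOn (hψ.mono fun p hp => hfib p hp)
  refine ⟨fun p t => B.act (γ t) (ψ p).2, ⟨hT₀, fun p _ => (hT p).isHorizontalLift hI hI'⟩,
    fun η hη => ?_, ?_, fun k hk J hJI hJ hJ' hcJ => ?_, fun t _ => ?_,
    fun hc₁ J φ hJ hJ' h0J hφ hmaps T' hT' p hp s hsJ => ?_⟩
  · exact (hη.isPiecewiseLift hch).eqOn hch hI (hT (η 0)) h0 (hT₀ _ (hη.proj_eq 0 h0)).symm
  · refine B.contMDiff_act.continuous.comp_continuousOn (ContinuousOn.prodMk ?_ ?_)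
    · exact hγ.continuousOn.comp continuousOn_snd fun x hx => hx.2
    · exact hψF.continuousOn.comp continuousOn_fst fun x hx => hx.1
  · refine (B.contMDiff_act.of_le (mod_cast le_top)).comp_contMDiffOn (ContMDiffOn.prodMk ?_ ?_)
    · exact (hγ.contMDiffOn hch hJI hJ hJ' hk hcJ).comp contMDiffOn_snd fun x hx => hx.2
    · exact (hψF.of_le (mod_cast le_top)).comp contMDiffOn_fst fun x hx => hx.1
  · exact B.contMDiff_act.comp_contMDiffOn (contMDiffOn_const.prodMk hψF)
  · have hhor := (hT p).isHorizontalOn hch subset_rfl hI hI' hc₁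
    -- No breaks are needed: `c` is `C¹` on `I`, so the transported curve is `C¹` there, and so is
    -- its composite with `φ` on `J`.
    have hη : IsPiecewiseLift C J (c ∘ φ) ((fun t => B.act (γ t) (ψ p).2) ∘ φ) :=
      ⟨hhor.1.continuousOn.comp hφ.continuousOn hmaps, fun t ht => (hT p).proj_eq _ (hmaps ht), ∅,
        fun a b _ => by simp, fun a b hab hsub _ =>
          hhor.comp_Icc hab (hφ.mono hsub) (hmaps.mono_left hsub)⟩
    have hq : B.proj (B.act (γ (φ 0)) (ψ p).2) = (c ∘ φ) 0 := (hT p).proj_eq _ (hmaps h0J)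
    exact hη.eqOn hch hJ ((hT'.isHorizontalLift _ hq).isPiecewiseLift hch) h0J
      (hT'.apply_zero _ hq).symm hsJ
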